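/- Let $n,m\ge 0$, $x=(x_0,\dots,x_n)$, ${\mathbf s}=(s_1,\dots,s_m)$. Let $f\in{\mathbb C}\{x\}$ be a germ of a holomorphic function on $X=({\mathbb C}^{n+1},0)$ with an isolated singularity at $0$, i.e. the differential $df$ has no zero in a punctured neighbourhood of $0$, and let $F\in{\mathbb C}\{x,{\mathbf s}\}$ be a deformation of $f$, i.e. $F|_{{\mathbf s}=0}=f$. For a power series $\Phi\in{\mathbb C}\{x\}[[{\mathbf s}]]$ (in particular for $\Phi=F$, and for $\Phi=f$, viewed as the trivial deformation) define the bi-formal Gauss–Manin system and the bi-formal Brieskorn lattice by $$\widehat G_{\Phi,\widehat S}:=H^{n+1}\bigl(\Omega^{\bullet}_{X,0}((u))[[{\mathbf s}]],\ u\,d-d\Phi\wedge\bigr),\qquad \widehat H''_{\Phi,\widehat S}:=H^{n+1}\bigl(\Omega^{\bullet}_{X,0}[[u]][[{\mathbf s}]],\ u\,d-d\Phi\wedge\bigr),$$ where $d$ is the differential in the variables $x$ only, acting coefficientwise in $u$ and ${\mathbf s}$. Proposition 1.2. The Milnor number $\mu:=\dim_{\mathbb C}{\mathbb C}\{x\}/(\partial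 f/\partial x_0,\dots,\partial f/\partial x_n)$ is finite, $\widehat G_{F,\widehat S}$ is a finite free module of rank $\mu$ over ${\mathbb C}((u))[[{\mathbf s}]]$, and $\widehat H''_{F,\widehat S}$ is a finite free module of rank $\mu$ over ${\mathbb C}[[u]][[{\mathbf s}]]={\mathbb C}[[u,s_1,\dots,s_m]]$. Likewise $\widehat G_{f,\widehat S}$ and $\widehat H''_{f,\widehat S}$ are finite free of rank $\mu$ over ${\mathbb C}((u))[[{\mathbf s}]]$ and ${\mathbb C}[[u,s_1,\dots,s_m]]$ respectively. -/

import Mathlib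

open scoped Topology

noncomputable section

namespace GaussManin

/-- The power series `∑ a_ν y^ν` with given coefficients. -/
def series {τ R : Type} (a : (τ →₀ ℕ) → R) : MvPowerSeries τ R := a

@[simp]
theorem coeff_series {τ R : Type} [Semiring R] (a : (τ →₀ ℕ) → R) (ν : τ →₀ ℕ) :
    MvPowerSeries.coeff ν (series a) = a ν := rfl

/-! ### Convergent power series -/

/-- A formal power series `∑ a_ν y^ν` over `ℂ` is convergent if `∑ |a_ν| r^|ν| < ∞` for some
`r > 0`. -/
def IsConvergent {σ : Type} (f : MvPowerSeries σ ℂ) : Prop :=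
  ∃ r : ℝ, 0 < r ∧ Summable fun ν : σ →₀ ℕ => ‖MvPowerSeries.coeff ν f‖ * r ^ ν.degree

theorem IsConvergent.mono_radius {σ : Type} {f : MvPowerSeries σ ℂ} {r s : ℝ} (hs : 0 < s)
    (hsr : s ≤ r)
    (h : Summable fun ν : σ →₀ ℕ => ‖MvPowerSeries.coeff ν f‖ * r ^ ν.degree) :
    Summable fun ν : σ →₀ ℕ => ‖MvPowerSeries.coeff ν f‖ * s ^ ν.degree := by
  refine Summable.of_nonneg_of_le (fun ν => by positivity) (fun ν => ?_) h
  gcongr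

theorem IsConvergent.add {σ : Type} {f g : MvPowerSeries σ ℂ} (hf : IsConvergent f)
    (hg : IsConvergent g) : IsConvergent (f + g) := by
  obtain ⟨r, hr, hf⟩ := hf
  obtain ⟨s, hs, hg⟩ := hg
  have hm : 0 < min r s := lt_min hr hs
  refine ⟨min r s, hm, ?_⟩
  refine Summable.of_nonneg_of_le (fun ν => by positivity) (fun ν => ?_)
    ((mono_radius hm (min_le_left _ _) hf).add (mono_radius hm (min_le_right _ _) hg))
  rw [← add_mul, map_add]
  gcongr
  exact norm_add_le _ _

open scoped Classical in
theorem summable_cauchy_product {σ : Type} (a b : (σ →₀ ℕ) → ℝ) (ha : ∀ ν, 0 ≤ a ν)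
    (hb : ∀ ν, 0 ≤ b ν) (hsa : Summable a) (hsb : Summable b) :
    Summable fun ν : σ →₀ ℕ => ∑ p ∈ Finset.HasAntidiagonal.antidiagonal ν, a p.1 * b p.2 :=
  summable_sum_mul_antidiagonal_of_summable_mul (hsa.mul_of_nonneg hsb ha hb)

theorem IsConvergent.mul {σ : Type} {f g : MvPowerSeries σ ℂ} (hf : IsConvergent f)
    (hg : IsConvergent g) : IsConvergent (f * g) := by
  classical
  obtain ⟨r, hr, hf⟩ := hf
  obtain ⟨s, hs, hg⟩ := hg
  have hm : 0 < min r s := lt_min hr hs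
  refine ⟨min r s, hm, ?_⟩
  have h1 := mono_radius hm (min_le_left _ _) hf
  have h2 := mono_radius hm (min_le_right _ _) hg
  generalize min r s = t at hm h1 h2
  have h3 := summable_cauchy_product _ _ (fun ν => by positivity) (fun ν => by positivity) h1 h2
  refine Summable.of_nonneg_of_le (fun ν => by positivity) (fun ν => ?_) h3
  have h4 : ‖MvPowerSeries.coeff ν (f * g)‖ ≤ ∑ p ∈ Finset.HasAntidiagonal.antidiagonal ν,
      ‖MvPowerSeries.coeff p.1 f‖ * ‖MvPowerSeries.coeff p.2 g‖ := by
    rw [MvPowerSeries.coeff_mul]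
    exact (norm_sum_le _ _).trans (le_of_eq (Finset.sum_congr rfl fun p _ => norm_mul _ _))
  refine (mul_le_mul_of_nonneg_right h4 (by positivity)).trans (le_of_eq ?_)
  rw [Finset.sum_mul]
  refine Finset.sum_congr rfl fun p hp => ?_
  have h5 : t ^ ν.degree = t ^ p.1.degree * t ^ p.2.degree := by
    rw [← Finset.HasAntidiagonal.mem_antidiagonal.1 hp, map_add, pow_add]
  rw [h5]
  exact mul_mul_mul_comm _ _ _ _

theorem IsConvergent.const {σ : Type} (c : ℂ) :
    IsConvergent (MvPowerSeries.C c : MvPowerSeries σ ℂ) := by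
  classical
  refine ⟨1, one_pos, summable_of_ne_finset_zero (s := {0}) fun ν hν => ?_⟩
  rw [MvPowerSeries.coeff_C, if_neg (by simpa using hν)]
  simp

theorem IsConvergent.pderiv {σ : Type} {f : MvPowerSeries σ ℂ} (hf : IsConvergent f) (i : σ) :
    IsConvergent (MvPowerSeries.pderiv ℂ i f) := by
  obtain ⟨r, hr, hf⟩ := hf
  refine ⟨r / 2, by positivity, ?_⟩
  have h1 := (hf.comp_injective (add_left_injective (Finsupp.single i 1))).mul_right r⁻¹
  refine Summable.of_nonneg_of_le (fun ν => by positivity) (fun ν => ?_) h1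
  have hk : ((ν i : ℝ) + 1) ≤ 2 ^ ν.degree := by
    have h2 : ν i + 1 ≤ 2 ^ ν.degree :=
      (Nat.succ_le_of_lt (Nat.lt_two_pow_self)).trans
        (Nat.pow_le_pow_right (by norm_num) (Finsupp.le_degree i ν))
    exact_mod_cast h2
  have hn : ‖((ν i : ℂ) + 1)‖ = (ν i : ℝ) + 1 := by
    have : ((ν i : ℂ) + 1) = ((ν i + 1 : ℕ) : ℂ) := by push_cast; rfl
    rw [this, Complex.norm_natCast]; push_cast; rfl
  simp only [Function.comp_apply]
  rw [MvPowerSeries.coeff_pderiv, norm_mul, hn, map_add, Finsupp.degree_single, pow_add, pow_one,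
    div_pow]
  calc _ = ‖MvPowerSeries.coeff (ν + Finsupp.single i 1) f‖ * r ^ ν.degree *
        (((ν i : ℝ) + 1) / 2 ^ ν.degree) := by ring
    _ ≤ ‖MvPowerSeries.coeff (ν + Finsupp.single i 1) f‖ * r ^ ν.degree * 1 := by
        gcongr
        exact (div_le_one (by positivity)).2 hk
    _ = _ := by field_simp

/-- The ring `ℂ{y}` of convergent power series in the variables `y_i`, `i ∈ σ`, that is, the ring
of germs at `0` of holomorphic functions. -/
def Conv (σ : Type) : Subalgebra ℂ (MvPowerSeries σ ℂ) where
  carrier := {f | IsConvergent f}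
  mul_mem' := IsConvergent.mul
  add_mem' := IsConvergent.add
  algebraMap_mem' c := IsConvergent.const c

/-- The partial derivative `∂/∂y_i` on `ℂ{y}`. -/
def Conv.pderiv {σ : Type} (i : σ) : Conv σ →ₗ[ℂ] Conv σ where
  toFun f := ⟨MvPowerSeries.pderiv ℂ i f.1, IsConvergent.pderiv f.2 i⟩
  map_add' f g := Subtype.ext (map_add (MvPowerSeries.pderiv ℂ i) f.1 g.1)
  map_smul' c f := Subtype.ext ((MvPowerSeries.pderiv ℂ i).map_smul c f.1)

theorem Conv.pderiv_comm {σ : Type} (i j : σ) (f : Conv σ) :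
    Conv.pderiv i (Conv.pderiv j f) = Conv.pderiv j (Conv.pderiv i f) := by
  classical
  apply Subtype.ext
  change MvPowerSeries.pderiv ℂ i (MvPowerSeries.pderiv ℂ j f.1) =
    MvPowerSeries.pderiv ℂ j (MvPowerSeries.pderiv ℂ i f.1)
  ext ν
  simp only [MvPowerSeries.coeff_pderiv, Finsupp.add_apply, Finsupp.single_apply, add_right_comm]
  by_cases h : i = j
  · subst h; rfl
  · rw [if_neg h, if_neg (Ne.symm h)]
    push_cast
    ring

theorem Conv.pderiv_mul {σ : Type} (i : σ) (f g : Conv σ) :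
    Conv.pderiv i (f * g) = f * Conv.pderiv i g + g * Conv.pderiv i f :=
  Subtype.ext ((MvPowerSeries.pderiv ℂ i).leibniz f.1 g.1)

/-- The value at the point `y` of the holomorphic function germ `f`; the series converges for `y`
in a neighbourhood of `0`. -/
def Conv.eval {σ : Type} [Fintype σ] (f : Conv σ) (y : σ → ℂ) : ℂ :=
  ∑' ν : σ →₀ ℕ, MvPowerSeries.coeff ν f.1 * ∏ i, y i ^ ν i

/-! ### Isolated singularities and the Milnor number -/

/-- The germ `f` has (at most) an isolated singularity at the origin: in a punctured neighbourhood
of `0` the differential `df` has no zero. -/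
def HasIsolatedSingularity {σ : Type} [Fintype σ] (f : Conv σ) : Prop :=
  ∀ᶠ x : σ → ℂ in 𝓝[≠] 0, ∃ i, Conv.eval (Conv.pderiv i f) x ≠ 0

/-- The Jacobian ideal `(∂f)`, generated by the partial derivatives of `f`. -/
def jacobianIdeal {σ : Type} (f : Conv σ) : Ideal (Conv σ) :=
  Ideal.span (Set.range fun i => Conv.pderiv i f)

/-- The Milnor algebra `ℂ{x}/(∂f)`. -/
abbrev MilnorAlgebra {σ : Type} (f : Conv σ) : Type := Conv σ ⧸ jacobianIdeal f

/-- The Milnor number `μ = dim_ℂ ℂ{x}/(∂f)`. -/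
def milnorNumber {σ : Type} (f : Conv σ) : ℕ := Module.finrank ℂ (MilnorAlgebra f)

/-! ### Deformations -/

/-- The coefficient `F_ν ∈ ℂ{x}` of `s^ν` in `F ∈ ℂ{x, s}`. -/
def sCoeff {σ τ : Type} (F : Conv (σ ⊕ τ)) (ν : τ →₀ ℕ) : Conv σ :=
  ⟨series fun α => MvPowerSeries.coeff (Finsupp.sumElim α ν) F.1, by
    obtain ⟨r, hr, h⟩ := F.2
    refine ⟨r, hr, ?_⟩
    have hinj : Function.Injective fun α : σ →₀ ℕ => Finsupp.sumElim α ν := by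
      intro α β hab
      ext i
      simpa using DFunLike.congr_fun hab (Sum.inl i)
    refine Summable.of_nonneg_of_le (fun α => by positivity) (fun α => ?_)
      ((h.comp_injective hinj).mul_right (r ^ ν.degree)⁻¹)
    have hdeg : (Finsupp.sumElim α ν).degree = α.degree + ν.degree := by
      classical
      simp only [Finsupp.degree_apply]
      have := Finsupp.sum_sumElim (f₁ := α) (f₂ := ν) (g := fun _ k => k)
      exact this
    simp only [Function.comp_apply, coeff_series]
    rw [hdeg, pow_add]
    refine le_of_eq ?_
    field_simp⟩

/-- The expansion `F = ∑ F_ν s^ν` in the deformation parameters: the inclusion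
`ℂ{x, s} ⊂ ℂ{x}[[s]]`. -/
def sExpand {σ τ : Type} (F : Conv (σ ⊕ τ)) : MvPowerSeries τ (Conv σ) := series fun ν => sCoeff F ν

/-- `F ∈ ℂ{x, s}` is a deformation of `f ∈ ℂ{x}`: its restriction to `s = 0` is `f`. -/
def IsDeformation {σ τ : Type} (f : Conv σ) (F : Conv (σ ⊕ τ)) : Prop :=
  sCoeff F 0 = f

/-! ### The twisted relative de Rham complex -/

/-- Relative `p`-forms `∑_I ω_I dx_I` in the coordinates `x_0, …, x_{N-1}` with coefficients
`ω_I` in `A`, where `I` runs over the `p`-element sets of indices, and `dx_I` is the wedge product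
in increasing order of the `dx_i` with `i ∈ I`. -/
abbrev Forms (N p : ℕ) (A : Type) : Type := {I : Finset (Fin N) // I.card = p} → A

/-- For operators `∇_i` on `A`, the map
`∑_J ω_J dx_J ↦ ∑_i ∑_J ∇_i(ω_J) dx_i ∧ dx_J` from `p`-forms to `(p+1)`-forms. -/
def formD {N : ℕ} {A B : Type} [AddCommGroup A] [CommRing B] [Module B A]
    (nabla : Fin N → A →ₗ[B] A) (p : ℕ) : Forms N p A →ₗ[B] Forms N (p + 1) A where
  toFun ω I := ∑ i : I.1, (-1 : ℤ) ^ (I.1.filter (· < i.1)).card •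
    nabla i.1 (ω ⟨I.1.erase i.1, by rw [Finset.card_erase_of_mem i.2, I.2, Nat.add_sub_cancel]⟩)
  map_add' ω η := by
    ext I
    simp only [Pi.add_apply, map_add, smul_add, Finset.sum_add_distrib]
  map_smul' b ω := by
    ext I
    simp only [Pi.smul_apply, map_smul, RingHom.id_apply, Finset.smul_sum]
    exact Finset.sum_congr rfl fun i _ => smul_comm _ _ _

theorem formD_apply_eq_sum {N : ℕ} {A B : Type} [AddCommGroup A] [CommRing B] [Module B A]
    (nabla : Fin N → A →ₗ[B] A) (p : ℕ) (ω : Forms N p A) (w : Finset (Fin N) → A)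
    (hw : ∀ J, ω J = w J.1) (I : {I : Finset (Fin N) // I.card = p + 1}) :
    formD nabla p ω I =
      ∑ i ∈ I.1, (-1 : ℤ) ^ (I.1.filter (· < i)).card • nabla i (w (I.1.erase i)) := by
  rw [← Finset.sum_coe_sort]
  exact Finset.sum_congr rfl fun i _ => by rw [hw]

theorem card_filter_erase {N : ℕ} (I : Finset (Fin N)) {i j : Fin N} (hi : i ∈ I) (hij : i < j) :
    (I.filter (· < j)).card = ((I.erase i).filter (· < j)).card + 1 ∧
    (I.filter (· < i)).card = ((I.erase j).filter (· < i)).card := by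
  constructor
  · rw [Finset.filter_erase, Finset.card_erase_add_one]
    simp [hi, hij]
  · rw [Finset.filter_erase, Finset.erase_eq_of_notMem]
    simp [hij.le]

theorem sign_swap {N : ℕ} (I : Finset (Fin N)) {i j : Fin N} (hi : i ∈ I) (hj : j ∈ I)
    (hij : i ≠ j) :
    (-1 : ℤ) ^ (I.filter (· < i)).card * (-1) ^ ((I.erase i).filter (· < j)).card +
      (-1) ^ (I.filter (· < j)).card * (-1) ^ ((I.erase j).filter (· < i)).card = 0 := by
  rcases lt_or_gt_of_ne hij with h | h
  · obtain ⟨h1, h2⟩ := card_filter_erase I hi h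
    rw [h1, h2]; ring
  · obtain ⟨h1, h2⟩ := card_filter_erase I hj h
    rw [h1, h2]; ring

/-- If the operators commute, `formD` is a differential. -/
theorem formD_formD {N : ℕ} {A B : Type} [AddCommGroup A] [CommRing B] [Module B A]
    (nabla : Fin N → A →ₗ[B] A) (hc : ∀ i j a, nabla i (nabla j a) = nabla j (nabla i a)) (p : ℕ)
    (ω : Forms N p A) : formD nabla (p + 1) (formD nabla p ω) = 0 := by
  classical
  ext I
  set w : Finset (Fin N) → A := fun J => if h : J.card = p then ω ⟨J, h⟩ else 0 with hw
  have h1 := formD_apply_eq_sum nabla p ω w (fun J => by simp [hw, J.2])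
  rw [formD_apply_eq_sum nabla (p + 1) _ (fun J => ∑ i ∈ J, (-1 : ℤ) ^ (J.filter (· < i)).card •
    nabla i (w (J.erase i))) h1]
  simp only [map_sum, map_zsmul, Finset.smul_sum, smul_smul, Pi.zero_apply]
  rw [Finset.sum_sigma']
  refine Finset.sum_involution (fun x _ => ⟨x.2, x.1⟩) ?_ ?_ ?_ ?_
  · rintro ⟨i, j⟩ h
    simp only [Finset.mem_sigma, Finset.mem_erase] at h
    dsimp only
    rw [hc j i, Finset.erase_right_comm, ← add_smul,
      sign_swap I.1 h.1 h.2.2 (fun e => h.2.1 e.symm), zero_smul]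
  · rintro ⟨i, j⟩ h _ e
    simp only [Finset.mem_sigma, Finset.mem_erase] at h
    simp only [Sigma.mk.injEq] at e
    exact h.2.1 e.1
  · rintro ⟨i, j⟩ h
    simp only [Finset.mem_sigma, Finset.mem_erase] at h ⊢
    exact ⟨h.2.2, fun e => h.2.1 e.symm, h.1⟩
  · rintro ⟨i, j⟩ h
    rfl

/-- The cohomology in degree `p + 1` of the complex of forms with differential `formD nabla`:
cocycles modulo coboundaries. -/
abbrev FormCohomology {N : ℕ} {A B : Type} [AddCommGroup A] [CommRing B] [Module B A]
    (nabla : Fin N → A →ₗ[B] A) (p : ℕ) : Type :=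
  LinearMap.ker (formD nabla (p + 1)) ⧸
    (LinearMap.range (formD nabla p)).submoduleOf (LinearMap.ker (formD nabla (p + 1)))

/-- A `K`-linear map `L → L` acting on `L[[s]]` coefficientwise. -/
def coeffwise {τ K L : Type} [CommRing K] [CommRing L] [Algebra K L] (D : L →ₗ[K] L) :
    MvPowerSeries τ L →ₗ[MvPowerSeries τ K] MvPowerSeries τ L where
  toFun a := series fun ν => D (MvPowerSeries.coeff ν a)
  map_add' a b := by
    ext ν
    simp
  map_smul' b a := by
    classical
    ext ν
    have e (κ : τ →₀ ℕ) : MvPowerSeries.coeff κ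
        (algebraMap (MvPowerSeries τ K) (MvPowerSeries τ L) b) =
        algebraMap K L (MvPowerSeries.coeff κ b) := by
      rw [MvPowerSeries.algebraMap_apply'']
      exact MvPowerSeries.coeff_map _ _ _
    rw [RingHom.id_apply, coeff_series, Algebra.smul_def, Algebra.smul_def,
      MvPowerSeries.coeff_mul, MvPowerSeries.coeff_mul, map_sum]
    refine Finset.sum_congr rfl fun p _ => ?_
    rw [e, coeff_series, ← Algebra.smul_def, ← Algebra.smul_def, map_smul]

/-- The `i`-th component `u ∂_{x_i} - ∂_{x_i}Φ` of the differential `u d - dΦ ∧` on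
`Ω_X ⊗ L[[s]]`. Here `K` (either `ℂ((u))` or `ℂ[[u]]`) contains the element `u`, `L` (either
`ℂ{x}((u))` or `ℂ{x}[[u]]`) is a `K`-algebra with an inclusion `j` of `ℂ{x}` and with
derivations `D i` (the `∂_{x_i}`), and `Φ ∈ ℂ{x}[[s]]`. -/
def nablaOp {N : ℕ} {τ K L : Type} [CommRing K] [CommRing L] [Algebra K L] (u : K)
    (D : Fin N → L →ₗ[K] L) (j : Conv (Fin N) →+* L) (Φ : MvPowerSeries τ (Conv (Fin N)))
    (i : Fin N) : MvPowerSeries τ L →ₗ[MvPowerSeries τ K] MvPowerSeries τ L :=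
  (MvPowerSeries.C u : MvPowerSeries τ K) • coeffwise (D i) -
    LinearMap.mulLeft (MvPowerSeries τ K)
      (series fun ν => j (Conv.pderiv i (MvPowerSeries.coeff ν Φ)))

theorem nablaOp_comm {N : ℕ} {τ K L : Type} [CommRing K] [CommRing L] [Algebra K L] (u : K)
    (D : Fin N → L →ₗ[K] L) (j : Conv (Fin N) →+* L)
    (hD : ∀ i k a, D i (D k a) = D k (D i a))
    (hj : ∀ i g a, D i (j g * a) = j g * D i a + j (Conv.pderiv i g) * a)
    (Φ : MvPowerSeries τ (Conv (Fin N))) (i k : Fin N) (a : MvPowerSeries τ L) :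
    nablaOp u D j Φ i (nablaOp u D j Φ k a) = nablaOp u D j Φ k (nablaOp u D j Φ i a) := by
  classical
  have h1 (i k) (a : MvPowerSeries τ L) : coeffwise (D i) (coeffwise (D k) a) =
      coeffwise (D k) (coeffwise (D i) a) := by
    ext ν
    exact hD _ _ _
  have h2 (i k) (a : MvPowerSeries τ L) :
      coeffwise (D i) ((series fun ν => j (Conv.pderiv k (MvPowerSeries.coeff ν Φ))) * a) =
      (series fun ν => j (Conv.pderiv k (MvPowerSeries.coeff ν Φ))) * coeffwise (D i) a +
      (series fun ν => j (Conv.pderiv i (Conv.pderiv k (MvPowerSeries.coeff ν Φ)))) * a := by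
    ext ν
    rw [map_add, MvPowerSeries.coeff_mul, MvPowerSeries.coeff_mul, ← Finset.sum_add_distrib]
    change D i (MvPowerSeries.coeff ν _) = _
    rw [MvPowerSeries.coeff_mul, map_sum]
    exact Finset.sum_congr rfl fun p _ => hj _ _ _
  have h3 : (series fun ν => j (Conv.pderiv i (Conv.pderiv k (MvPowerSeries.coeff ν Φ)))) =
      series fun ν => j (Conv.pderiv k (Conv.pderiv i (MvPowerSeries.coeff ν Φ))) := by
    congr 1; funext ν; rw [Conv.pderiv_comm]
  simp only [nablaOp, LinearMap.sub_apply, LinearMap.smul_apply, LinearMap.mulLeft_apply, map_sub,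
    map_smul, h1 i k, h2, h3, smul_add, smul_sub,
    mul_left_comm (series fun ν => j (Conv.pderiv i (MvPowerSeries.coeff ν Φ)))]
  abel

/-! ### The coefficient rings with `((u))` and `[[u]]` -/

/-- The inclusion `ℂ((u)) → ℂ{x}((u))`. -/
def laurentMap (σ : Type) : LaurentSeries ℂ →+* LaurentSeries (Conv σ) where
  toFun a := a.map (algebraMap ℂ (Conv σ))
  map_one' := HahnSeries.map_one (algebraMap ℂ (Conv σ)).toMonoidWithZeroHom
  map_mul' _ _ := HahnSeries.map_mul (algebraMap ℂ (Conv σ)).toNonUnitalRingHom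
  map_zero' := HahnSeries.map_zero ((algebraMap ℂ (Conv σ) : ℂ →+ Conv σ) : ZeroHom ℂ (Conv σ))
  map_add' _ _ := HahnSeries.map_add (algebraMap ℂ (Conv σ)).toAddMonoidHom

instance laurentAlgebra (σ : Type) : Algebra (LaurentSeries ℂ) (LaurentSeries (Conv σ)) :=
  (laurentMap σ).toAlgebra

/-- `ℂ{x}((u))[[s]]` as an algebra over `ℂ((u))[[s]]`, coefficientwise in `s`. -/
instance laurentSeriesAlgebra (σ τ : Type) :
    Algebra (MvPowerSeries τ (LaurentSeries ℂ)) (MvPowerSeries τ (LaurentSeries (Conv σ))) :=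
  MvPowerSeries.algebraMvPowerSeries

instance laurentSeriesModule (σ τ : Type) :
    Module (MvPowerSeries τ (LaurentSeries ℂ)) (MvPowerSeries τ (LaurentSeries (Conv σ))) :=
  Algebra.toModule

/-- The derivation `∂_{x_i}` acting on the coefficients of a Laurent series in `ℂ{x}((u))`. -/
def laurentD {σ : Type} (i : σ) :
    LaurentSeries (Conv σ) →ₗ[LaurentSeries ℂ] LaurentSeries (Conv σ) where
  toFun a := a.map (Conv.pderiv i)
  map_add' a b := by
    ext1; funext k
    simp
  map_smul' b a := by
    ext1; funext k
    rw [RingHom.id_apply, Algebra.smul_def, Algebra.smul_def]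
    have hs : (a.map (Conv.pderiv i)).support ⊆ a.support := fun k hk h => hk (by
      rw [HahnSeries.map_coeff, h, map_zero])
    rw [HahnSeries.map_coeff, HahnSeries.coeff_mul, map_sum,
      HahnSeries.coeff_mul_right' a.isPWO_support hs]
    refine Finset.sum_congr rfl fun p _ => ?_
    have e : (algebraMap (LaurentSeries ℂ) (LaurentSeries (Conv σ)) b).coeff p.1 =
        algebraMap ℂ (Conv σ) (b.coeff p.1) := rfl
    rw [e, HahnSeries.map_coeff, ← Algebra.smul_def, ← Algebra.smul_def, map_smul]

/-- The derivation `∂_{x_i}` acting on the coefficients of a power series in `ℂ{x}[[u]]`. -/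
def powerD {σ : Type} (i : σ) : PowerSeries (Conv σ) →ₗ[PowerSeries ℂ] PowerSeries (Conv σ) :=
  coeffwise (τ := Unit) (Conv.pderiv i)

/-! ### The bi-formal Gauss-Manin system and Brieskorn lattice -/

/-- The operators `u ∂_{x_i} - ∂_{x_i}Φ` on `ℂ{x}((u))[[s]]`. -/
def laurentNabla {N : ℕ} {τ : Type} (Φ : MvPowerSeries τ (Conv (Fin N))) (i : Fin N) :
    MvPowerSeries τ (LaurentSeries (Conv (Fin N))) →ₗ[MvPowerSeries τ (LaurentSeries ℂ)]
      MvPowerSeries τ (LaurentSeries (Conv (Fin N))) :=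
  nablaOp (K := LaurentSeries ℂ) (L := LaurentSeries (Conv (Fin N)))
    (HahnSeries.single 1 1) laurentD HahnSeries.C Φ i

/-- The operators `u ∂_{x_i} - ∂_{x_i}Φ` on `ℂ{x}[[u]][[s]]`. -/
def powerNabla {N : ℕ} {τ : Type} (Φ : MvPowerSeries τ (Conv (Fin N))) (i : Fin N) :
    MvPowerSeries τ (PowerSeries (Conv (Fin N))) →ₗ[MvPowerSeries τ (PowerSeries ℂ)]
      MvPowerSeries τ (PowerSeries (Conv (Fin N))) :=
  nablaOp (K := PowerSeries ℂ) (L := PowerSeries (Conv (Fin N)))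
    PowerSeries.X powerD PowerSeries.C Φ i

theorem laurentNabla_comm {N : ℕ} {τ : Type} (Φ : MvPowerSeries τ (Conv (Fin N))) (i k : Fin N)
    (a : MvPowerSeries τ (LaurentSeries (Conv (Fin N)))) :
    laurentNabla Φ i (laurentNabla Φ k a) = laurentNabla Φ k (laurentNabla Φ i a) := by
  refine nablaOp_comm _ _ _ (fun i k a => ?_) (fun i g a => ?_) Φ i k a
  · ext1; funext l
    exact Conv.pderiv_comm _ _ _
  · ext1; funext l
    change Conv.pderiv i ((HahnSeries.C g * a).coeff l) =
      (HahnSeries.C g * laurentD i a + HahnSeries.C (Conv.pderiv i g) * a).coeff l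
    rw [HahnSeries.coeff_add, HahnSeries.C_apply, HahnSeries.C_apply,
      HahnSeries.coeff_single_zero_mul, HahnSeries.coeff_single_zero_mul,
      HahnSeries.coeff_single_zero_mul, Conv.pderiv_mul, mul_comm (a.coeff l)]
    rfl

theorem powerNabla_comm {N : ℕ} {τ : Type} (Φ : MvPowerSeries τ (Conv (Fin N))) (i k : Fin N)
    (a : MvPowerSeries τ (PowerSeries (Conv (Fin N)))) :
    powerNabla Φ i (powerNabla Φ k a) = powerNabla Φ k (powerNabla Φ i a) := by
  have e (i : Fin N) (b : PowerSeries (Conv (Fin N))) (l : ℕ) :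
      PowerSeries.coeff l (powerD i b) = Conv.pderiv i (PowerSeries.coeff l b) := rfl
  refine nablaOp_comm _ _ _ (fun i k a => ?_) (fun i g a => ?_) Φ i k a
  · ext1 l
    exact Conv.pderiv_comm _ _ _
  · ext1 l
    rw [e, map_add, PowerSeries.coeff_C_mul, PowerSeries.coeff_C_mul, PowerSeries.coeff_C_mul, e,
      Conv.pderiv_mul, mul_comm (PowerSeries.coeff l a)]

/-- `(Ω^•_{X,0}((u))[[s]], u d - dΦ ∧)` is a complex. -/
theorem laurent_formD_formD {N : ℕ} {τ : Type} (Φ : MvPowerSeries τ (Conv (Fin N))) (p : ℕ)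
    (ω : Forms N p (MvPowerSeries τ (LaurentSeries (Conv (Fin N))))) :
    formD (B := MvPowerSeries τ (LaurentSeries ℂ)) (laurentNabla Φ) (p + 1)
      (formD (B := MvPowerSeries τ (LaurentSeries ℂ)) (laurentNabla Φ) p ω) = 0 :=
  formD_formD _ (laurentNabla_comm Φ) p ω

/-- `(Ω^•_{X,0}[[u]][[s]], u d - dΦ ∧)` is a complex. -/
theorem power_formD_formD {N : ℕ} {τ : Type} (Φ : MvPowerSeries τ (Conv (Fin N))) (p : ℕ)
    (ω : Forms N p (MvPowerSeries τ (PowerSeries (Conv (Fin N))))) :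
    formD (B := MvPowerSeries τ (PowerSeries ℂ)) (powerNabla Φ) (p + 1)
      (formD (B := MvPowerSeries τ (PowerSeries ℂ)) (powerNabla Φ) p ω) = 0 :=
  formD_formD _ (powerNabla_comm Φ) p ω

/-- The bi-formal Gauss-Manin system of `Φ ∈ ℂ{x}[[s]]`: `H^{n+1}` of the complex
`(Ω^•_{X,0}((u))[[s]], u d - dΦ ∧)` with `dim X = n + 1`. It is a module over `ℂ((u))[[s]]`.
For a deformation `F` of `f` take `Φ = sExpand F`; for the trivial deformation `f` of `f`, the
expansion in `s` is the constant series `Φ = C f`. -/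
abbrev GaussManinSystem {n : ℕ} {τ : Type} (Φ : MvPowerSeries τ (Conv (Fin (n + 1)))) : Type :=
  FormCohomology (A := MvPowerSeries τ (LaurentSeries (Conv (Fin (n + 1)))))
    (B := MvPowerSeries τ (LaurentSeries ℂ)) (laurentNabla Φ) n

/-- The bi-formal Brieskorn lattice of `Φ ∈ ℂ{x}[[s]]`: `H^{n+1}` of the complex
`(Ω^•_{X,0}[[u]][[s]], u d - dΦ ∧)` with `dim X = n + 1`. It is a module over
`ℂ[[u]][[s]] = ℂ[[u, s]]`. -/
abbrev BrieskornLattice {n : ℕ} {τ : Type} (Φ : MvPowerSeries τ (Conv (Fin (n + 1)))) : Type :=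
  FormCohomology (A := MvPowerSeries τ (PowerSeries (Conv (Fin (n + 1)))))
    (B := MvPowerSeries τ (PowerSeries ℂ)) (powerNabla Φ) n

/-- `M` is a finite free module of rank `r` over `B`. -/
def IsFiniteFreeOfRank (B M : Type) [CommRing B] [AddCommGroup M] [Module B M] (r : ℕ) : Prop :=
  Module.Free B M ∧ Module.Finite B M ∧ Module.finrank B M = r

end GaussManin

end

open scoped Topology

noncomputable section

namespace GaussManin

open scoped NNReal ENNReal
open Filter

/-! The complex is filtered by powers of `u` and of `s`, and freeness is read off from leading
terms. At `u = 0`, `s = 0` the operators `u ∂_i - ∂_iΦ` become multiplication by `-∂_i f`: the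
complex becomes the Koszul complex of the partial derivatives of `f`, and its top cohomology the
Milnor algebra. A basis of the Milnor algebra then lifts. Generation only needs generation of
leading terms. Independence also needs exactness one step below the top, so that the leading part of
a relation can be removed by a coboundary. The structure `Resolves` packages both facts,
`exists_eq_of_hasLeading` passes from leading terms to power series by successive approximation, and
`resolves_lift` applies it to `u` and then to `s`. For the Gauss–Manin system, `u` is inverted
between these two steps (`Resolves.localize`). The deformation enters only through its value at `s =
0`.

Two facts about `f` start the argument. The Milnor algebra is finite-dimensional by
`finite_quotient_of_isolated_zero`: Weierstrass division and resultants eliminate one variable at a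
time, and the isolated zero survives the elimination. The Koszul complex is exact below the top
because finite codimension puts powers `x_i^k` into the Jacobian ideal; these powers form a regular
sequence of full length, and `exists_eq_kosD_add_of_isWeaklyRegular` turns such a sequence into
vanishing of homology. -/

/-! ### Weighted norms of power series -/

/-- The value `w^ν` of the monomial with exponent `ν` at a tuple `w` of radii. -/
def weight {σ : Type} (w : σ → ℝ≥0) (ν : σ →₀ ℕ) : ℝ≥0 := ν.prod fun i k => w i ^ k

theorem weight_add {σ : Type} (w : σ → ℝ≥0) (ν κ : σ →₀ ℕ) :
    weight w (ν + κ) = weight w ν * weight w κ :=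
  Finsupp.prod_add_index' (fun _ => pow_zero _) (fun _ _ _ => pow_add _ _ _)

theorem weight_pos {σ : Type} {w : σ → ℝ≥0} (hw : ∀ i, 0 < w i) (ν : σ →₀ ℕ) :
    0 < weight w ν :=
  Finset.prod_pos fun i _ => pow_pos (hw i) _

theorem weight_mono {σ : Type} {w w' : σ → ℝ≥0} (h : ∀ i, w i ≤ w' i) (ν : σ →₀ ℕ) :
    weight w ν ≤ weight w' ν :=
  Finset.prod_le_prod' fun i _ => pow_le_pow_left' (h i) _

theorem weight_single {σ : Type} (w : σ → ℝ≥0) (i : σ) (k : ℕ) :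
    weight w (Finsupp.single i k) = w i ^ k :=
  Finsupp.prod_single_index (pow_zero _)

theorem weight_const {σ : Type} (r : ℝ≥0) (ν : σ →₀ ℕ) :
    weight (fun _ => r) ν = r ^ ν.degree := by
  rw [weight, Finsupp.prod, Finset.prod_pow_eq_pow_sum, Finsupp.degree_apply]

/-- The weighted norm `∑ |f_ν| w^ν` of a power series. -/
def wnorm {σ : Type} (w : σ → ℝ≥0) (f : MvPowerSeries σ ℂ) : ℝ≥0∞ :=
  ∑' ν, ((‖MvPowerSeries.coeff ν f‖₊ * weight w ν : ℝ≥0) : ℝ≥0∞)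

theorem wnorm_mono {σ : Type} {w w' : σ → ℝ≥0} (h : ∀ i, w i ≤ w' i) (f : MvPowerSeries σ ℂ) :
    wnorm w f ≤ wnorm w' f :=
  ENNReal.tsum_le_tsum fun ν => by
    gcongr
    exact weight_mono h ν

theorem coeff_le_wnorm {σ : Type} (w : σ → ℝ≥0) (f : MvPowerSeries σ ℂ) (ν : σ →₀ ℕ) :
    ((‖MvPowerSeries.coeff ν f‖₊ * weight w ν : ℝ≥0) : ℝ≥0∞) ≤ wnorm w f :=
  ENNReal.le_tsum ν

theorem wnorm_add_le {σ : Type} (w : σ → ℝ≥0) (f g : MvPowerSeries σ ℂ) :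
    wnorm w (f + g) ≤ wnorm w f + wnorm w g := by
  rw [wnorm, wnorm, wnorm, ← ENNReal.tsum_add]
  refine ENNReal.tsum_le_tsum fun ν => ?_
  rw [← ENNReal.coe_add, ← add_mul, map_add]
  gcongr
  exact nnnorm_add_le _ _

/-- The Cauchy product is regrouped along antidiagonals; with values in `ℝ≥0∞` this needs no
summability. -/
theorem wnorm_mul_le {σ : Type} (w : σ → ℝ≥0) (f g : MvPowerSeries σ ℂ) :
    wnorm w (f * g) ≤ wnorm w f * wnorm w g := by
  classical
  set a : (σ →₀ ℕ) → ℝ≥0∞ := fun ν =>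
    ((‖MvPowerSeries.coeff ν f‖₊ * weight w ν : ℝ≥0) : ℝ≥0∞) with ha
  set b : (σ →₀ ℕ) → ℝ≥0∞ := fun ν =>
    ((‖MvPowerSeries.coeff ν g‖₊ * weight w ν : ℝ≥0) : ℝ≥0∞) with hb
  have h1 : wnorm w f * wnorm w g = ∑' p : (σ →₀ ℕ) × (σ →₀ ℕ), a p.1 * b p.2 := by
    rw [ENNReal.tsum_prod' (f := fun p : (σ →₀ ℕ) × (σ →₀ ℕ) => a p.1 * b p.2)]
    simp only [ENNReal.tsum_mul_left, ENNReal.tsum_mul_right]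
    rfl
  rw [h1, ← Finset.HasAntidiagonal.sigmaAntidiagonalEquivProd.tsum_eq, ENNReal.tsum_sigma']
  refine ENNReal.tsum_le_tsum fun ν => ?_
  have h2 : ∑' q : Finset.HasAntidiagonal.antidiagonal ν,
      a (q : (σ →₀ ℕ) × (σ →₀ ℕ)).1 * b (q : (σ →₀ ℕ) × (σ →₀ ℕ)).2 =
      ∑ q ∈ Finset.HasAntidiagonal.antidiagonal ν, a q.1 * b q.2 :=
    Finset.tsum_subtype (Finset.HasAntidiagonal.antidiagonal ν) fun q => a q.1 * b q.2
  refine le_trans ?_ (le_of_eq h2.symm)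
  simp only [ha, hb]
  norm_cast
  rw [MvPowerSeries.coeff_mul]
  refine (mul_le_mul_left (nnnorm_sum_le _ _) _).trans ?_
  rw [Finset.sum_mul]
  refine Finset.sum_le_sum fun q hq => le_of_eq ?_
  rw [← Finset.HasAntidiagonal.mem_antidiagonal.1 hq, weight_add, nnnorm_mul]
  exact mul_mul_mul_comm _ _ _ _

theorem wnorm_lt_top_iff {σ : Type} (w : σ → ℝ≥0) (f : MvPowerSeries σ ℂ) :
    wnorm w f < ∞ ↔ Summable fun ν => ‖MvPowerSeries.coeff ν f‖ * (weight w ν : ℝ) := by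
  rw [lt_top_iff_ne_top, wnorm, ENNReal.tsum_coe_ne_top_iff_summable, ← NNReal.summable_coe]
  simp

theorem exists_wnorm_lt_top {σ : Type} {f : MvPowerSeries σ ℂ} (hf : IsConvergent f) :
    ∃ r : ℝ≥0, 0 < r ∧ wnorm (fun _ => r) f < ∞ := by
  obtain ⟨r, hr, h⟩ := hf
  lift r to ℝ≥0 using hr.le
  refine ⟨r, NNReal.coe_pos.1 hr, (wnorm_lt_top_iff _ _).2 ?_⟩
  simpa [weight_const] using h

theorem isConvergent_of_wnorm_lt_top {σ : Type} [Finite σ] {w : σ → ℝ≥0} (hw : ∀ i, 0 < w i)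
    {f : MvPowerSeries σ ℂ} (hf : wnorm w f < ∞) : IsConvergent f := by
  obtain ⟨r, hr, h⟩ : ∃ r : ℝ≥0, 0 < r ∧ ∀ i, r ≤ w i := by
    cases isEmpty_or_nonempty σ
    · exact ⟨1, one_pos, fun i => isEmptyElim i⟩
    · obtain ⟨i, hi⟩ := Finite.exists_min w
      exact ⟨w i, hw i, hi⟩
  refine ⟨r, hr, ?_⟩
  have := (wnorm_lt_top_iff (fun _ => r) f).1 ((wnorm_mono h f).trans_lt hf)
  simpa [weight_const] using this

/-! ### A fixed point lemma -/

/-- The quotient of the division of `f` by the monomial with exponent `δ`. -/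
def shiftDown {σ : Type} (δ : σ →₀ ℕ) (f : MvPowerSeries σ ℂ) : MvPowerSeries σ ℂ :=
  series fun ν => MvPowerSeries.coeff (ν + δ) f

theorem wnorm_shiftDown {σ : Type} (w : σ → ℝ≥0) (δ : σ →₀ ℕ) (f : MvPowerSeries σ ℂ) :
    wnorm w (shiftDown δ f) * weight w δ ≤ wnorm w f := by
  rw [wnorm, ← ENNReal.tsum_mul_right]
  refine le_trans (le_of_eq ?_) (ENNReal.tsum_comp_le_tsum_of_injective
    (add_left_injective δ) fun ν => ((‖MvPowerSeries.coeff ν f‖₊ * weight w ν : ℝ≥0) : ℝ≥0∞))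
  refine tsum_congr fun ν => ?_
  rw [← ENNReal.coe_mul]
  simp only [shiftDown, coeff_series, weight_add, mul_assoc]

/-- The map `h ↦ shiftDown δ h * p` shrinks the weighted norm by the factor `wnorm w p / weight w δ
< 1`, so the Neumann series of its iterates at `f` converges. With `δ = 0` this inverts `1 - p`;
with `δ` a power of `x_0` it is Weierstrass division. -/
theorem exists_eq_add_shiftDown_mul {σ : Type} {w : σ → ℝ≥0} (hw : ∀ i, 0 < w i)
    (δ : σ →₀ ℕ) {p : MvPowerSeries σ ℂ} (hp : wnorm w p < weight w δ)
    {f : MvPowerSeries σ ℂ} (hf : wnorm w f < ∞) :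
    ∃ h : MvPowerSeries σ ℂ, wnorm w h < ∞ ∧ h = f + shiftDown δ h * p := by
  classical
  have hδ : (weight w δ : ℝ≥0∞) ≠ 0 := by simpa using (weight_pos hw δ).ne'
  set θ : ℝ≥0∞ := wnorm w p / weight w δ with hθ
  have hθ1 : θ < 1 := ENNReal.div_lt_of_lt_mul (by simpa using hp)
  set t : ℕ → MvPowerSeries σ ℂ := fun k => (fun h => shiftDown δ h * p)^[k] f with ht
  have ht1 (k) : t (k + 1) = shiftDown δ (t k) * p := Function.iterate_succ_apply' _ _ _
  have hstep (h : MvPowerSeries σ ℂ) : wnorm w (shiftDown δ h * p) ≤ θ * wnorm w h := by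
    refine (wnorm_mul_le _ _ _).trans ?_
    have h1 : wnorm w (shiftDown δ h) ≤ wnorm w h / weight w δ :=
      (ENNReal.le_div_iff_mul_le (Or.inl hδ) (Or.inl ENNReal.coe_ne_top)).2 (wnorm_shiftDown w δ h)
    refine (mul_le_mul_left h1 _).trans (le_of_eq ?_)
    rw [hθ, ENNReal.div_eq_inv_mul, ENNReal.div_eq_inv_mul]
    ring
  have hbound (k : ℕ) : wnorm w (t k) ≤ θ ^ k * wnorm w f := by
    induction k with
    | zero => simp [ht]
    | succ k ih =>
      rw [ht1, pow_succ', mul_assoc]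
      exact (hstep _).trans (mul_le_mul_right ih _)
  have hsum : ∑' k, wnorm w (t k) < ∞ := by
    refine (ENNReal.tsum_le_tsum hbound).trans_lt ?_
    rw [ENNReal.tsum_mul_right, ENNReal.tsum_geometric]
    refine ENNReal.mul_lt_top ?_ hf
    rw [ENNReal.inv_lt_top]
    exact tsub_pos_of_lt hθ1
  -- A single coefficient is controlled by the norm because its weight is positive; the sum of the
  -- series is then formed coefficientwise.
  have hsc (ν : σ →₀ ℕ) : Summable fun k => ‖MvPowerSeries.coeff ν (t k)‖₊ := by
    have h1 : Summable fun k => ‖MvPowerSeries.coeff ν (t k)‖₊ * weight w ν :=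
      ENNReal.tsum_coe_ne_top_iff_summable.1
        ((ENNReal.tsum_le_tsum fun k => coeff_le_wnorm w (t k) ν).trans_lt hsum).ne
    have h2 := h1.mul_right (weight w ν)⁻¹
    simpa only [mul_inv_cancel_right₀ (weight_pos hw ν).ne'] using h2
  have hsc' (ν : σ →₀ ℕ) : Summable fun k => MvPowerSeries.coeff ν (t k) :=
    Summable.of_nnnorm (hsc ν)
  refine ⟨series fun ν => ∑' k, MvPowerSeries.coeff ν (t k), ?_, ?_⟩
  · refine lt_of_le_of_lt ?_ hsum
    simp only [wnorm]
    rw [ENNReal.tsum_comm]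
    refine ENNReal.tsum_le_tsum fun ν => ?_
    rw [← ENNReal.coe_tsum (((hsc ν)).mul_right _), NNReal.tsum_mul_right, coeff_series]
    gcongr
    exact nnnorm_tsum_le (hsc ν)
  · ext ν
    rw [coeff_series, map_add, (hsc' ν).tsum_eq_zero_add]
    congr 1
    rw [MvPowerSeries.coeff_mul]
    simp only [ht1, MvPowerSeries.coeff_mul, shiftDown, coeff_series]
    have h1 := Summable.tsum_finsetSum (s := Finset.HasAntidiagonal.antidiagonal ν)
      (f := fun (q : (σ →₀ ℕ) × (σ →₀ ℕ)) (k : ℕ) =>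
        MvPowerSeries.coeff (q.1 + δ) (t k) * MvPowerSeries.coeff q.2 p)
      fun q _ => (hsc' (q.1 + δ)).mul_right (MvPowerSeries.coeff q.2 p)
    refine h1.trans (Finset.sum_congr rfl fun q _ => ?_)
    exact (hsc' (q.1 + δ)).tsum_mul_right _

/-! ### Evaluation of convergent power series -/

theorem wnorm_C {σ : Type} (w : σ → ℝ≥0) (c : ℂ) :
    wnorm w (MvPowerSeries.C c : MvPowerSeries σ ℂ) = ‖c‖₊ := by
  classical
  rw [wnorm, tsum_eq_single 0]
  · simp [weight]
  · intro ν hν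
    simp [MvPowerSeries.coeff_C, hν]

theorem wnorm_X {σ : Type} (w : σ → ℝ≥0) (i : σ) :
    wnorm w (MvPowerSeries.X i : MvPowerSeries σ ℂ) = w i := by
  classical
  rw [wnorm, tsum_eq_single (Finsupp.single i 1)]
  · simp [MvPowerSeries.coeff_X, weight_single]
  · intro ν hν
    simp [MvPowerSeries.coeff_X, hν]

/-- The algebra of the convergent power series that converge absolutely at the point `y`. -/
def AbsConv {σ : Type} (y : σ → ℂ) : Subalgebra ℂ (Conv σ) where
  carrier := {f | wnorm (fun i => ‖y i‖₊) f.1 < ∞}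
  mul_mem' {f g} hf hg := (wnorm_mul_le _ f.1 g.1).trans_lt (ENNReal.mul_lt_top hf hg)
  add_mem' {f g} hf hg := (wnorm_add_le _ f.1 g.1).trans_lt (ENNReal.add_lt_top.2 ⟨hf, hg⟩)
  algebraMap_mem' c := by
    change wnorm _ (MvPowerSeries.C c) < ∞
    rw [wnorm_C]
    exact ENNReal.coe_lt_top

theorem prod_pow_eq {σ : Type} [Fintype σ] (y : σ → ℂ) (ν : σ →₀ ℕ) :
    ∏ i, y i ^ ν i = ν.prod fun i k => y i ^ k :=
  (Finsupp.prod_fintype _ _ fun _ => pow_zero _).symm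

theorem norm_prod_pow {σ : Type} [Fintype σ] (y : σ → ℂ) (ν : σ →₀ ℕ) :
    ‖∏ i, y i ^ ν i‖ = weight (fun i => ‖y i‖₊) ν := by
  rw [weight, Finsupp.prod_fintype _ _ fun _ => pow_zero _, norm_prod]
  simp

theorem summable_norm_of_mem {σ : Type} [Fintype σ] {y : σ → ℂ} {f : Conv σ} (hf : f ∈ AbsConv y) :
    Summable fun ν : σ →₀ ℕ => ‖MvPowerSeries.coeff ν f.1 * ∏ i, y i ^ ν i‖ := by
  have := (wnorm_lt_top_iff _ _).1 hf
  simpa only [norm_mul, norm_prod_pow] using this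

theorem eval_C {σ : Type} [Fintype σ] (c : ℂ) (y : σ → ℂ) :
    Conv.eval (algebraMap ℂ (Conv σ) c) y = c := by
  classical
  have h (ν : σ →₀ ℕ) : MvPowerSeries.coeff ν (algebraMap ℂ (Conv σ) c).1 =
      if ν = 0 then c else 0 := MvPowerSeries.coeff_C ν c
  rw [Conv.eval, tsum_eq_single 0]
  · rw [h, if_pos rfl]
    simp
  · intro ν hν
    rw [h, if_neg hν, zero_mul]

theorem eval_add {σ : Type} [Fintype σ] {y : σ → ℂ} {f g : Conv σ} (hf : f ∈ AbsConv y)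
    (hg : g ∈ AbsConv y) : Conv.eval (f + g) y = Conv.eval f y + Conv.eval g y := by
  have h1 := (summable_norm_of_mem hf).of_norm
  have h2 := (summable_norm_of_mem hg).of_norm
  have h3 (ν : σ →₀ ℕ) : MvPowerSeries.coeff ν (f + g).1 =
    MvPowerSeries.coeff ν f.1 + MvPowerSeries.coeff ν g.1 := map_add _ _ _
  simp only [Conv.eval, h3, add_mul]
  exact h1.tsum_add h2

theorem coeff_mul_mul_prod_pow {σ : Type} [Fintype σ] [DecidableEq σ] (f g : MvPowerSeries σ ℂ)
    (y : σ → ℂ) (ν : σ →₀ ℕ) : MvPowerSeries.coeff ν (f * g) * ∏ i, y i ^ ν i =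
      ∑ q ∈ Finset.HasAntidiagonal.antidiagonal ν,
        (MvPowerSeries.coeff q.1 f * ∏ i, y i ^ q.1 i) *
          (MvPowerSeries.coeff q.2 g * ∏ i, y i ^ q.2 i) := by
  rw [MvPowerSeries.coeff_mul, Finset.sum_mul]
  refine Finset.sum_congr rfl fun q hq => ?_
  rw [← Finset.HasAntidiagonal.mem_antidiagonal.1 hq]
  simp only [Finsupp.add_apply, pow_add, Finset.prod_mul_distrib]
  exact mul_mul_mul_comm _ _ _ _

theorem tsum_mul_tsum_antidiagonal {σ : Type} [DecidableEq σ] {a b c : (σ →₀ ℕ) → ℂ}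
    (ha : Summable fun ν => ‖a ν‖) (hb : Summable fun ν => ‖b ν‖)
    (hc : ∀ ν, c ν = ∑ q ∈ Finset.HasAntidiagonal.antidiagonal ν, a q.1 * b q.2) :
    ∑' ν, c ν = (∑' ν, a ν) * ∑' ν, b ν := by
  rw [ha.of_norm.tsum_mul_tsum_eq_tsum_sum_antidiagonal hb.of_norm
    (summable_mul_of_summable_norm ha hb)]
  exact tsum_congr hc

theorem eval_mul {σ : Type} [Fintype σ] {y : σ → ℂ} {f g : Conv σ} (hf : f ∈ AbsConv y)
    (hg : g ∈ AbsConv y) : Conv.eval (f * g) y = Conv.eval f y * Conv.eval g y := by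
  classical
  exact tsum_mul_tsum_antidiagonal (summable_norm_of_mem hf) (summable_norm_of_mem hg)
    (coeff_mul_mul_prod_pow f.1 g.1 y)

/-- Evaluation at `y` as a homomorphism. -/
def evalHom {σ : Type} [Fintype σ] (y : σ → ℂ) : AbsConv y →+* ℂ where
  toFun f := Conv.eval f.1 y
  map_one' := (congrArg (fun f => Conv.eval f y) (map_one (algebraMap ℂ (Conv σ)))).symm.trans
    (eval_C 1 y)
  map_zero' := (congrArg (fun f => Conv.eval f y) (map_zero (algebraMap ℂ (Conv σ)))).symm.trans
    (eval_C 0 y)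
  map_add' f g := eval_add f.2 g.2
  map_mul' f g := eval_mul f.2 g.2

@[simp]
theorem evalHom_apply {σ : Type} [Fintype σ] (y : σ → ℂ) (f : AbsConv y) :
    evalHom y f = Conv.eval f.1 y := rfl

theorem weight_le_of_norm_le {σ : Type} {y : σ → ℂ} {r : ℝ≥0} (h : ∀ i, ‖y i‖₊ ≤ r)
    (ν : σ →₀ ℕ) : weight (fun i => ‖y i‖₊) ν ≤ r ^ ν.degree :=
  (weight_mono h ν).trans (weight_const r ν).le

theorem eventually_nnnorm_le {σ : Type} [Fintype σ] {r : ℝ≥0} (hr : 0 < r) :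
    ∀ᶠ y : σ → ℂ in 𝓝 0, ∀ i, ‖y i‖₊ ≤ r := by
  filter_upwards [Metric.ball_mem_nhds (0 : σ → ℂ) (NNReal.coe_pos.2 hr)] with y hy i
  rw [mem_ball_zero_iff] at hy
  exact_mod_cast (norm_le_pi_norm y i).trans hy.le

/-- Evaluation is multiplicative and additive only where the series converge absolutely, since a
divergent `tsum` has a default value. Any finite set of identities between germs can therefore be
evaluated near `0`. -/
theorem eventually_mem_absConv {σ : Type} [Fintype σ] (f : Conv σ) :
    ∀ᶠ y : σ → ℂ in 𝓝 0, f ∈ AbsConv y := by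
  obtain ⟨r, hr, h⟩ := exists_wnorm_lt_top f.2
  filter_upwards [eventually_nnnorm_le hr] with y hy
  exact (wnorm_mono hy _).trans_lt h

theorem eval_zero_eq {σ : Type} [Fintype σ] (f : Conv σ) :
    Conv.eval f 0 = MvPowerSeries.constantCoeff f.1 := by
  rw [Conv.eval, tsum_eq_single 0]
  · simp
  · intro ν hν
    obtain ⟨i, hi⟩ := DFunLike.ne_iff.1 hν
    rw [Finset.prod_eq_zero (Finset.mem_univ i) (zero_pow (by simpa using hi)), mul_zero]

/-- Dominated convergence. Continuity at the origin is all that is needed: it keeps units away from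
zero and Weierstrass coefficients small. -/
theorem tendsto_eval_zero {σ : Type} [Fintype σ] (f : Conv σ) :
    Tendsto (Conv.eval f) (𝓝 0) (𝓝 (MvPowerSeries.constantCoeff f.1)) := by
  obtain ⟨r, hr, h⟩ := exists_wnorm_lt_top f.2
  have h1 := (wnorm_lt_top_iff _ _).1 h
  rw [← eval_zero_eq]
  refine tendsto_tsum_of_dominated_convergence h1 (fun ν => ?_) ?_
  · refine (Continuous.tendsto ?_ 0)
    fun_prop
  · filter_upwards [eventually_nnnorm_le hr] with y hy ν
    rw [norm_mul, norm_prod_pow, weight_const]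
    gcongr
    exact weight_le_of_norm_le hy ν

/-! ### Units and coordinates -/

/-- After division by the constant term `c`, the germ is `1 - p` with `p` vanishing at `0`; on a
small polydisc `p` has norm below `1` and the geometric series converges. -/
theorem isUnit_of_constantCoeff_ne_zero {σ : Type} [Finite σ] (f : Conv σ)
    (hf : MvPowerSeries.constantCoeff f.1 ≠ 0) : IsUnit f := by
  classical
  set c := MvPowerSeries.constantCoeff f.1 with hc
  set p : MvPowerSeries σ ℂ := MvPowerSeries.C 1 - MvPowerSeries.C c⁻¹ * f.1 with hp
  have hpc : IsConvergent p :=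
    (Conv σ).sub_mem (IsConvergent.const 1) (IsConvergent.mul (IsConvergent.const _) f.2)
  have hp0 : MvPowerSeries.coeff 0 p = 0 := by
    simp [hp, ← hc, inv_mul_cancel₀ hf]
  obtain ⟨r, hr, h⟩ := exists_wnorm_lt_top hpc
  obtain ⟨s, hs, hps⟩ : ∃ s : ℝ≥0, 0 < s ∧ wnorm (fun _ : σ => s) p < 1 := by
    -- Shrinking the radius by `t` gains at least one factor `t` on every monomial of positive
    -- degree, and `p` has no constant term.
    have key (t : ℝ≥0) (ht : t ≤ 1) :
        wnorm (fun _ : σ => t * r) p ≤ t * wnorm (fun _ => r) p := by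
      rw [wnorm, wnorm, ← ENNReal.tsum_mul_left]
      refine ENNReal.tsum_le_tsum fun ν => ?_
      rw [← ENNReal.coe_mul, weight_const, weight_const]
      rcases eq_or_ne ν 0 with rfl | hν
      · simp [hp0]
      · have h2 : t ^ ν.degree ≤ t := pow_le_of_le_one (zero_le) ht (by simpa [Finsupp.degree_eq_zero_iff] using hν)
        rw [mul_pow, mul_left_comm]
        gcongr
    set M := (wnorm (fun _ : σ => r) p).toNNReal with hM
    have hM' : wnorm (fun _ : σ => r) p = M := (ENNReal.coe_toNNReal h.ne).symm
    refine ⟨(M + 1)⁻¹ * r, by positivity, (key (M + 1)⁻¹ (inv_le_one_of_one_le₀ (by simp))).trans_lt ?_⟩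
    rw [hM', ← ENNReal.coe_mul]
    have : (M + 1)⁻¹ * M < 1 := by
      rw [inv_mul_lt_iff₀ (by positivity), mul_one]
      exact lt_add_one M
    exact_mod_cast this
  obtain ⟨g, hg, hg'⟩ := exists_eq_add_shiftDown_mul (w := fun _ : σ => s) (fun _ => hs) 0
    (p := p) (by simpa [weight] using hps) (f := MvPowerSeries.C 1) (by rw [wnorm_C]; simp)
  have h0 : shiftDown 0 g = g := by
    ext ν
    simp [shiftDown]
  rw [h0] at hg'
  have hgc := isConvergent_of_wnorm_lt_top (w := fun _ : σ => s) (fun _ => hs) hg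
  refine .of_mul_eq_one (algebraMap ℂ (Conv σ) c⁻¹ * ⟨g, hgc⟩) (Subtype.ext ?_)
  change f.1 * (MvPowerSeries.C c⁻¹ * g) = 1
  have e1 : (MvPowerSeries.C 1 : MvPowerSeries σ ℂ) = 1 := map_one _
  rw [hp, e1] at hg'
  linear_combination hg'

/-- The coordinate function `x_i`. -/
def Conv.X {σ : Type} (i : σ) : Conv σ :=
  ⟨MvPowerSeries.X i, by
    classical
    refine ⟨1, one_pos, summable_of_ne_finset_zero (s := {Finsupp.single i 1}) fun ν hν => ?_⟩
    rw [MvPowerSeries.coeff_X, if_neg (by simpa using hν)]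
    simp⟩

theorem eval_X {σ : Type} [Fintype σ] (i : σ) (y : σ → ℂ) : Conv.eval (Conv.X i) y = y i := by
  classical
  have h (ν : σ →₀ ℕ) : MvPowerSeries.coeff ν (Conv.X i).1 =
      if ν = Finsupp.single i 1 then 1 else 0 := MvPowerSeries.coeff_X ν i
  rw [Conv.eval, tsum_eq_single (Finsupp.single i 1)]
  · rw [h, if_pos rfl, one_mul, prod_pow_eq,
      Finsupp.prod_single_index (h := fun i k => y i ^ k) (pow_zero _), pow_one]
  · intro ν hν
    rw [h, if_neg hν, zero_mul]

theorem X_mem_absConv {σ : Type} (i : σ) (y : σ → ℂ) : Conv.X i ∈ AbsConv y := by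
  change wnorm _ (MvPowerSeries.X i) < ∞
  rw [wnorm_X]
  exact ENNReal.coe_lt_top

/-! ### Adding a variable -/

theorem embDomain_succEmb {n : ℕ} (ν : Fin n →₀ ℕ) :
    Finsupp.embDomain (Fin.succEmb n) ν = Finsupp.cons 0 ν := by
  ext i
  cases i using Fin.cases with
  | zero =>
    rw [Finsupp.cons_zero, Finsupp.embDomain_of_notMem_range]
    rintro ⟨j, hj⟩
    exact Fin.succ_ne_zero j hj
  | succ i =>
    rw [Finsupp.cons_succ]
    exact Finsupp.embDomain_apply_self (Fin.succEmb n) ν i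

theorem coeff_rename_succEmb {n : ℕ} (f : MvPowerSeries (Fin n) ℂ) (ν : Fin (n + 1) →₀ ℕ) :
    MvPowerSeries.coeff ν (MvPowerSeries.rename (Fin.succEmb n) f) =
      if ν 0 = 0 then MvPowerSeries.coeff ν.tail f else 0 := by
  split_ifs with h
  · have h1 : ν = Finsupp.embDomain (Fin.succEmb n) ν.tail := by
      rw [embDomain_succEmb, ← h, Finsupp.cons_tail]
    conv_lhs => rw [h1]
    rw [MvPowerSeries.coeff_embDomain_rename]
  · refine MvPowerSeries.coeff_rename_eq_zero _ _ ?_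
    rintro ⟨κ, hκ⟩
    rw [← Finsupp.embDomain_eq_mapDomain, embDomain_succEmb] at hκ
    exact h (by rw [← hκ, Finsupp.cons_zero])

theorem weight_cons {n : ℕ} (w : Fin (n + 1) → ℝ≥0) (k : ℕ) (ν : Fin n →₀ ℕ) :
    weight w (Finsupp.cons k ν) = w 0 ^ k * weight (fun i => w i.succ) ν := by
  rw [weight, weight, Finsupp.prod_fintype _ _ fun _ => pow_zero _,
    Finsupp.prod_fintype _ _ fun _ => pow_zero _, Fin.prod_univ_succ]
  simp

theorem wnorm_rename {n : ℕ} (w : Fin (n + 1) → ℝ≥0) (f : MvPowerSeries (Fin n) ℂ) :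
    wnorm w (MvPowerSeries.rename (Fin.succEmb n) f) = wnorm (fun i => w i.succ) f := by
  symm
  rw [wnorm, wnorm, ← (Finsupp.cons_right_injective (n := n) (M := ℕ) (y := 0)).tsum_eq]
  · refine tsum_congr fun ν => ?_
    rw [coeff_rename_succEmb, weight_cons]
    simp
  · intro ν hν
    refine ⟨ν.tail, ?_⟩
    by_contra h
    have h0 : ν 0 ≠ 0 := fun e => h (by rw [← e, Finsupp.cons_tail])
    rw [Function.mem_support, coeff_rename_succEmb, if_neg h0] at hν
    simp at hν

/-- The inclusion `ℂ{x_1, …, x_n} → ℂ{x_0, x_1, …, x_n}`. -/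
def Conv.incl (n : ℕ) : Conv (Fin n) →ₐ[ℂ] Conv (Fin (n + 1)) :=
  ((MvPowerSeries.rename (Fin.succEmb n)).comp (Conv (Fin n)).val).codRestrict (Conv (Fin (n + 1)))
    fun f => by
      obtain ⟨r, hr, h⟩ := exists_wnorm_lt_top f.2
      refine isConvergent_of_wnorm_lt_top (w := fun _ => r) (fun _ => hr) ?_
      exact (wnorm_rename (fun _ => r) f.1).trans_lt h

theorem coeff_incl {n : ℕ} (f : Conv (Fin n)) (ν : Fin (n + 1) →₀ ℕ) :
    MvPowerSeries.coeff ν (Conv.incl n f).1 =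
      if ν 0 = 0 then MvPowerSeries.coeff ν.tail f.1 else 0 :=
  coeff_rename_succEmb f.1 ν

theorem incl_mem_absConv {n : ℕ} {f : Conv (Fin n)} {y : Fin n → ℂ} (hf : f ∈ AbsConv y) (z : ℂ) :
    Conv.incl n f ∈ AbsConv (Fin.cons z y : Fin (n + 1) → ℂ) := by
  change wnorm _ (MvPowerSeries.rename (Fin.succEmb n) f.1) < ∞
  rw [wnorm_rename]
  exact hf

theorem eval_incl {n : ℕ} (f : Conv (Fin n)) (y : Fin n → ℂ) (z : ℂ) :
    Conv.eval (Conv.incl n f) (Fin.cons z y : Fin (n + 1) → ℂ) = Conv.eval f y := by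
  symm
  rw [Conv.eval, Conv.eval, ← (Finsupp.cons_right_injective (n := n) (M := ℕ) (y := 0)).tsum_eq]
  · refine tsum_congr fun ν => ?_
    rw [coeff_incl, Fin.prod_univ_succ]
    simp
  · intro ν hν
    refine ⟨ν.tail, ?_⟩
    by_contra h
    have h0 : ν 0 ≠ 0 := fun e => h (by rw [← e, Finsupp.cons_tail])
    rw [Function.mem_support, coeff_incl, if_neg h0] at hν
    simp at hν

/-! ### Weierstrass division -/

/-- The pure powers of `x_0` in `p` have exponent above `d`, so they become small against `x_0^d`
when the radius of `x_0` shrinks. All other monomials contain another variable, whose radius is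
shrunk afterwards, depending on the first choice. -/
theorem exists_wnorm_lt_weight {n d : ℕ} {p : MvPowerSeries (Fin (n + 1)) ℂ}
    (hp : ∀ k ≤ d, MvPowerSeries.coeff (Finsupp.single 0 k) p = 0) {r : ℝ≥0} (hr : 0 < r)
    (hpr : wnorm (fun _ => r) p < ∞) :
    ∃ w : Fin (n + 1) → ℝ≥0, (∀ i, 0 < w i) ∧ (∀ i, w i ≤ r) ∧
      wnorm w p < weight w (Finsupp.single 0 d) := by
  set M := (wnorm (fun _ : Fin (n + 1) => r) p).toNNReal with hM
  have hM' : wnorm (fun _ : Fin (n + 1) => r) p = M := (ENNReal.coe_toNNReal hpr.ne).symm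
  -- The constants give `s * M ≤ r^d / 4` and `t * M ≤ (s * r)^d / 4`, so the two kinds of monomials
  -- together contribute at most half of `(s * r)^d`.
  set s : ℝ≥0 := min 1 (r ^ d / (4 * (M + 1))) with hs
  have hs0 : 0 < s := lt_min one_pos (by positivity)
  have hs1 : s ≤ 1 := min_le_left _ _
  set t : ℝ≥0 := min 1 ((s * r) ^ d / (4 * (M + 1))) with ht
  have ht0 : 0 < t := lt_min one_pos (by positivity)
  have ht1 : t ≤ 1 := min_le_left _ _
  have hb {a b : ℝ≥0} (h : a ≤ b / (4 * (M + 1))) : a * M ≤ b / 4 := by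
    rw [le_div_iff₀ (by positivity)] at h ⊢
    refine le_trans ?_ h
    rw [mul_assoc, mul_comm M]
    gcongr
    exact le_self_add
  refine ⟨Fin.cons (s * r) fun _ => t * r, fun i => ?_, fun i => ?_, ?_⟩
  · cases i using Fin.cases with
    | zero => exact mul_pos hs0 hr
    | succ i => exact mul_pos ht0 hr
  · cases i using Fin.cases <;> simp
    · exact mul_le_of_le_one_left' hs1
    · exact mul_le_of_le_one_left' ht1
  have key : wnorm (Fin.cons (s * r) fun _ => t * r : Fin (n + 1) → ℝ≥0) p ≤
      ((s ^ (d + 1) + t : ℝ≥0) : ℝ≥0∞) * wnorm (fun _ => r) p := by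
    rw [wnorm, wnorm, ← ENNReal.tsum_mul_left]
    refine ENNReal.tsum_le_tsum fun ν => ?_
    rw [← ENNReal.coe_mul, mul_left_comm]
    by_cases h0 : MvPowerSeries.coeff ν p = 0
    · simp [h0]
    have h1 : weight (Fin.cons (s * r) fun _ => t * r : Fin (n + 1) → ℝ≥0) ν =
        (s ^ ν 0 * t ^ ν.tail.degree) * weight (fun _ => r) ν := by
      conv_lhs => rw [← Finsupp.cons_tail ν]
      conv_rhs => rw [← Finsupp.cons_tail ν]
      rw [weight_cons, weight_cons]
      simp only [Fin.cons_zero, Fin.cons_succ, weight_const, Finsupp.cons_zero, Finsupp.tail_cons,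
        mul_pow]
      exact mul_mul_mul_comm _ _ _ _
    rw [h1]
    gcongr
    by_cases h2 : ν.tail = 0
    · have h3 : d + 1 ≤ ν 0 := by
        by_contra h4
        refine h0 ?_
        rw [← Finsupp.cons_tail ν, h2, Finsupp.cons_zero_eq_single_zero]
        exact hp _ (by omega)
      rw [h2]
      simp only [map_zero, pow_zero, mul_one]
      exact (pow_le_pow_of_le_one (zero_le) hs1 h3).trans le_self_add
    · have h3 : ν.tail.degree ≠ 0 := by simpa [Finsupp.degree_eq_zero_iff] using h2
      calc s ^ ν 0 * t ^ ν.tail.degree ≤ 1 * t :=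
            mul_le_mul' (pow_le_one₀ (zero_le) hs1) (pow_le_of_le_one (zero_le) ht1 h3)
        _ ≤ _ := by rw [one_mul]; exact le_add_self
  refine key.trans_lt ?_
  rw [hM', ← ENNReal.coe_mul, weight_single, ENNReal.coe_lt_coe, Fin.cons_zero]
  have h1 : s ^ (d + 1) * M ≤ (s * r) ^ d / 4 := by
    rw [pow_succ, mul_assoc, mul_pow, mul_div_assoc]
    gcongr
    exact hb (min_le_right _ _)
  have h2 : t * M ≤ (s * r) ^ d / 4 := hb (min_le_right _ _)
  have h3 : 0 < (s * r) ^ d := by positivity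
  rw [add_mul]
  rw [← NNReal.coe_lt_coe]
  rw [← NNReal.coe_le_coe] at h1 h2
  rw [← NNReal.coe_lt_coe] at h3
  push_cast at *
  linarith

theorem isConvergent_slice {n : ℕ} {w : Fin (n + 1) → ℝ≥0} (hw : ∀ i, 0 < w i)
    {h : MvPowerSeries (Fin (n + 1)) ℂ} (hh : wnorm w h < ∞) (k : ℕ) :
    IsConvergent (series fun ν : Fin n →₀ ℕ => MvPowerSeries.coeff (Finsupp.cons k ν) h) := by
  refine isConvergent_of_wnorm_lt_top (w := fun i => w i.succ) (fun i => hw _) ?_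
  have h1 : wnorm (fun i => w i.succ)
      (series fun ν : Fin n →₀ ℕ => MvPowerSeries.coeff (Finsupp.cons k ν) h) * (w 0 ^ k : ℝ≥0) ≤
      wnorm w h := by
    rw [wnorm, wnorm, ← ENNReal.tsum_mul_right]
    refine le_trans (le_of_eq ?_) (ENNReal.tsum_comp_le_tsum_of_injective
      (Finsupp.cons_right_injective (n := n) (M := ℕ) (y := k)) _)
    refine tsum_congr fun ν => ?_
    rw [weight_cons, ← ENNReal.coe_mul, coeff_series]
    congr 1
    ring
  by_contra h2
  rw [not_lt, top_le_iff] at h2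
  rw [h2, ENNReal.top_mul (by simpa using fun e => ((hw 0).ne' e).elim)] at h1
  exact (h1.trans_lt hh).ne rfl

theorem eq_sum_slice_add {n : ℕ} (d : ℕ) (h : MvPowerSeries (Fin (n + 1)) ℂ)
    (a : Fin d → Conv (Fin n))
    (ha : ∀ k ν, MvPowerSeries.coeff ν (a k).1 = MvPowerSeries.coeff (Finsupp.cons k ν) h) :
    h = ∑ k, (Conv.incl n (a k)).1 * MvPowerSeries.X 0 ^ (k : ℕ) +
      shiftDown (Finsupp.single 0 d) h * MvPowerSeries.X 0 ^ d := by
  classical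
  ext ν
  rw [map_add, map_sum]
  simp only [MvPowerSeries.X_pow_eq, MvPowerSeries.coeff_mul_monomial, Finsupp.single_le_iff,
    mul_one, coeff_incl, shiftDown, coeff_series]
  have h1 (k : Fin d) : (if (k : ℕ) ≤ ν 0 then
      if (ν - Finsupp.single 0 (k : ℕ) : Fin (n + 1) →₀ ℕ) 0 = 0 then
        MvPowerSeries.coeff (ν - Finsupp.single 0 (k : ℕ) : Fin (n + 1) →₀ ℕ).tail (a k).1 else 0 else 0) =
      if (k : ℕ) = ν 0 then MvPowerSeries.coeff ν h else 0 := by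
    rw [← ite_and]
    refine if_ctx_congr ?_ (fun e => ?_) fun _ => rfl
    · simp
      omega
    · rw [ha, e]
      congr 2
      ext i
      cases i using Fin.cases with
      | zero => simp
      | succ i => simp [Finsupp.tail_apply]
  rw [Finset.sum_congr rfl fun k _ => h1 k]
  by_cases h2 : d ≤ ν 0
  · rw [if_pos h2, tsub_add_cancel_of_le (by simpa using h2), Finset.sum_eq_zero, zero_add]
    intro k _
    rw [if_neg]
    omega
  · rw [if_neg h2, add_zero, Finset.sum_eq_single ⟨ν 0, not_le.1 h2⟩]
    · simp
    · intro k _ hk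
      rw [if_neg]
      exact fun e => hk (Fin.ext e)
    · simp

/-- Weierstrass division (existence). -/
theorem exists_weierstrass_division {n d : ℕ} (g : Conv (Fin (n + 1)))
    (hlow : ∀ k < d, MvPowerSeries.coeff (Finsupp.single 0 k) g.1 = 0)
    (hd : MvPowerSeries.coeff (Finsupp.single 0 d) g.1 ≠ 0) (f : Conv (Fin (n + 1))) :
    ∃ (a : Fin d → Conv (Fin n)) (q : Conv (Fin (n + 1))),
      f = ∑ k, Conv.incl n (a k) * Conv.X 0 ^ (k : ℕ) + q * g := by
  classical
  set c := MvPowerSeries.coeff (Finsupp.single 0 d) g.1 with hc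
  -- Normalising `g` cancels `x_0^d` as well, so `p` has no monomial `x_0^k` with `k ≤ d`.
  set p' : Conv (Fin (n + 1)) := Conv.X 0 ^ d - algebraMap ℂ _ c⁻¹ * g with hp'
  set p : MvPowerSeries (Fin (n + 1)) ℂ := p'.1 with hp
  have hpe : p = MvPowerSeries.X 0 ^ d - MvPowerSeries.C c⁻¹ * g.1 := rfl
  have hp0 : ∀ k ≤ d, MvPowerSeries.coeff (Finsupp.single 0 k) p = 0 := by
    intro k hk
    rw [hpe, map_sub, MvPowerSeries.coeff_C_mul, MvPowerSeries.coeff_X_pow]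
    rcases hk.eq_or_lt with rfl | hk
    · rw [if_pos rfl, ← hc, inv_mul_cancel₀ hd, sub_self]
    · rw [if_neg, hlow k hk, mul_zero, sub_zero]
      exact fun e => hk.ne (Finsupp.single_injective 0 e)
  obtain ⟨r, hr, hpr⟩ := exists_wnorm_lt_top p'.2
  obtain ⟨s, hs, hfs⟩ := exists_wnorm_lt_top f.2
  have hpm : wnorm (fun _ => min r s) p < ∞ :=
    (wnorm_mono (fun _ => min_le_left _ _) _).trans_lt hpr
  obtain ⟨w, hw, hwr, hwp⟩ := exists_wnorm_lt_weight hp0 (lt_min hr hs) hpm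
  -- Let `q` be the quotient of `h` by `x_0^d`. Then `f = h - q p`, and `h` is its part of degree
  -- below `d` in `x_0` plus `q x_0^d`; since `x_0^d - p = c⁻¹ g`, this is the division.
  obtain ⟨h, hh, he⟩ := exists_eq_add_shiftDown_mul hw _ hwp
    ((wnorm_mono (fun i => (hwr i).trans (min_le_right _ _)) f.1).trans_lt hfs)
  have hq : IsConvergent (shiftDown (Finsupp.single 0 d) h) := by
    refine isConvergent_of_wnorm_lt_top hw ?_
    by_contra h2
    rw [not_lt, top_le_iff] at h2
    have h1 := wnorm_shiftDown w (Finsupp.single 0 d) h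
    rw [h2, ENNReal.top_mul (by simpa using (weight_pos hw _).ne')] at h1
    exact (h1.trans_lt hh).ne rfl
  refine ⟨fun k => ⟨_, isConvergent_slice hw hh k⟩, algebraMap ℂ _ c⁻¹ * ⟨_, hq⟩, Subtype.ext ?_⟩
  have h3 := eq_sum_slice_add d h (fun k => ⟨_, isConvergent_slice hw hh k⟩) fun k ν => rfl
  have h4 : f.1 = h - shiftDown (Finsupp.single 0 d) h * p := eq_sub_of_add_eq he.symm
  rw [h4, hpe]
  push_cast
  change _ = _ + MvPowerSeries.C c⁻¹ * shiftDown (Finsupp.single 0 d) h * g.1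
  have h5 : ∑ k : Fin d, (Conv.incl n ⟨_, isConvergent_slice hw hh k⟩).1 *
      (Conv.X 0 : Conv (Fin (n + 1))).1 ^ (k : ℕ) =
      h - shiftDown (Finsupp.single 0 d) h * MvPowerSeries.X 0 ^ d :=
    (sub_eq_of_eq_add h3).symm
  rw [h5]
  ring

/-! ### Polynomials with given coefficients -/

/-- The polynomial `∑_{k < d} a_k X^k`. -/
def truncPoly {R : Type} [CommRing R] {d : ℕ} (a : Fin d → R) : Polynomial R :=
  ∑ k, Polynomial.C (a k) * Polynomial.X ^ (k : ℕ)

theorem degree_truncPoly_lt {R : Type} [CommRing R] {d : ℕ} (a : Fin d → R) :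
    (truncPoly a).degree < d :=
  Polynomial.degree_sum_fin_lt a

theorem map_truncPoly {R S : Type} [CommRing R] [CommRing S] {d : ℕ} (φ : R →+* S)
    (a : Fin d → R) : (truncPoly a).map φ = truncPoly fun k => φ (a k) := by
  simp [truncPoly, Polynomial.map_sum]

theorem eval₂_truncPoly {R S : Type} [CommRing R] [CommRing S] {d : ℕ} (φ : R →+* S) (z : S)
    (a : Fin d → R) : (truncPoly a).eval₂ φ z = ∑ k, φ (a k) * z ^ (k : ℕ) := by
  simp [truncPoly, Polynomial.eval₂_finsetSum]

theorem eval_truncPoly {R : Type} [CommRing R] {d : ℕ} (z : R)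
    (a : Fin d → R) : (truncPoly a).eval z = ∑ k, a k * z ^ (k : ℕ) := by
  simp [truncPoly, Polynomial.eval_finsetSum]

theorem natDegree_truncPoly_le {R : Type} [CommRing R] {d : ℕ} (a : Fin d → R) :
    (truncPoly a).natDegree ≤ d :=
  Polynomial.natDegree_le_of_degree_le (degree_truncPoly_lt a).le

/-! ### Elimination of one variable by resultants. -/

/-- The resultant of `X^d - ∑ w_k X^k` and `∑ b_k X^k`. -/
def elimination {R : Type} [CommRing R] {d : ℕ} (w b : Fin d → R) : R :=
  Polynomial.resultant (Polynomial.X ^ d - truncPoly w) (truncPoly b) d (d + 1)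

theorem map_elimination {R S : Type} [CommRing R] [CommRing S] {d : ℕ} (φ : R →+* S)
    (w b : Fin d → R) :
    elimination (fun k => φ (w k)) (fun k => φ (b k)) = φ (elimination w b) := by
  rw [elimination, elimination, ← Polynomial.resultant_map_map, Polynomial.map_sub,
    map_truncPoly, map_truncPoly, Polynomial.map_pow, Polynomial.map_X]

/-- A resultant lies in the ideal generated by its two polynomials. Evaluated at `z = x_0`, this
puts the eliminant into any ideal containing both values. -/
theorem exists_map_elimination_eq {R S : Type} [CommRing R] [CommRing S] {d : ℕ} (φ : R →+* S)
    (w b : Fin d → R) (z : S) : ∃ p q : S, φ (elimination w b) =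
      (z ^ d - ∑ k, φ (w k) * z ^ (k : ℕ)) * p + (∑ k, φ (b k) * z ^ (k : ℕ)) * q := by
  have h1 : (Polynomial.X ^ d - truncPoly w).natDegree ≤ d :=
    (Polynomial.natDegree_sub_le _ _).trans
      (max_le (Polynomial.natDegree_X_pow_le d) (natDegree_truncPoly_le w))
  -- The generous formal degree `d + 1` is nonzero even for `d = 0`, as the Bézout identity
  -- requires; the first polynomial being monic, it does no harm to the product formula over the
  -- roots.
  obtain ⟨p, q, -, -, h⟩ := Polynomial.exists_mul_add_mul_eq_C_resultant (m := d) (n := d + 1)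
    _ _ h1
    ((natDegree_truncPoly_le b).trans (Nat.le_succ d)) (Or.inr (Nat.succ_ne_zero d))
  refine ⟨p.eval₂ φ z, q.eval₂ φ z, ?_⟩
  have h2 := congrArg (Polynomial.eval₂ φ z) h
  rw [Polynomial.eval₂_add, Polynomial.eval₂_mul, Polynomial.eval₂_mul, Polynomial.eval₂_sub,
    Polynomial.eval₂_X_pow, eval₂_truncPoly, eval₂_truncPoly, Polynomial.eval₂_C] at h2
  exact h2.symm

theorem exists_root_of_elimination_eq_zero {d : ℕ} {w b : Fin d → ℂ} (h : elimination w b = 0) :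
    ∃ z ∈ (Polynomial.X ^ d - truncPoly w).roots, ∑ k, b k * z ^ (k : ℕ) = 0 := by
  have h1 : (Polynomial.X ^ d - truncPoly w).Monic :=
    Polynomial.monic_X_pow_sub (degree_truncPoly_lt w)
  have h2 : (Polynomial.X ^ d - truncPoly w).natDegree = d := by
    refine Polynomial.natDegree_eq_of_degree_eq_some ?_
    rw [Polynomial.degree_sub_eq_left_of_degree_lt] <;> rw [Polynomial.degree_X_pow]
    exact degree_truncPoly_lt w
  have h3 := Polynomial.resultant_eq_prod_eval (Polynomial.X ^ d - truncPoly w) (truncPoly b)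
    (d + 1) ((natDegree_truncPoly_le b).trans (Nat.le_succ d)) (IsAlgClosed.splits _)
  rw [h2, h1.leadingCoeff, one_pow, one_mul] at h3
  rw [elimination, h3, Multiset.prod_eq_zero_iff, Multiset.mem_map] at h
  obtain ⟨z, hz, hz'⟩ := h
  exact ⟨z, hz, by rw [← hz', eval_truncPoly]⟩

/-- For `ε ≤ ‖z‖` every `‖z‖^k ε^d` with `k < d` is at most `‖z‖^d`, whence `ε^d ≤ ∑ ‖w k‖`. The
bound keeps the roots of a Weierstrass polynomial close to `0` when its parameters are. -/
theorem norm_lt_of_mem_roots {d : ℕ} {w : Fin d → ℂ} {ε : ℝ} (hε : 0 < ε) (hε1 : ε ≤ 1)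
    (hw : ∑ k, ‖w k‖ < ε ^ d) {z : ℂ} (hz : z ^ d = ∑ k, w k * z ^ (k : ℕ)) : ‖z‖ < ε := by
  by_contra hlt
  rw [not_lt] at hlt
  have hz0 : 0 < ‖z‖ := hε.trans_le hlt
  have h1 (k : Fin d) : ‖z‖ ^ (k : ℕ) * ε ^ d ≤ ‖z‖ ^ d := by
    calc ‖z‖ ^ (k : ℕ) * ε ^ d ≤ ‖z‖ ^ (k : ℕ) * ε ^ (d - k) := by
          gcongr ?_ * ?_
          exact pow_le_pow_of_le_one hε.le hε1 (Nat.sub_le _ _)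
      _ ≤ ‖z‖ ^ (k : ℕ) * ‖z‖ ^ (d - k) := by gcongr
      _ = ‖z‖ ^ d := by rw [← pow_add, Nat.add_sub_cancel' k.2.le]
  have h2 : ‖z‖ ^ d * ε ^ d ≤ (∑ k, ‖w k‖) * ‖z‖ ^ d := by
    calc ‖z‖ ^ d * ε ^ d = ‖∑ k, w k * z ^ (k : ℕ)‖ * ε ^ d := by rw [← norm_pow, hz]
      _ ≤ (∑ k, ‖w k‖ * ‖z‖ ^ (k : ℕ)) * ε ^ d := by
          gcongr
          refine (norm_sum_le _ _).trans (le_of_eq ?_)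
          simp
      _ = ∑ k, ‖w k‖ * (‖z‖ ^ (k : ℕ) * ε ^ d) := by
          rw [Finset.sum_mul]
          exact Finset.sum_congr rfl fun k _ => mul_assoc _ _ _
      _ ≤ ∑ k, ‖w k‖ * ‖z‖ ^ d := Finset.sum_le_sum fun k _ => by
          gcongr
          exact h1 k
      _ = _ := by rw [Finset.sum_mul]
  have h3 : 0 < ‖z‖ ^ d := by positivity
  nlinarith

/-- If for sufficiently many values of `t` the polynomials `∑ t^i r_i` have a zero in a given
finite set, then the `r_i` have a common zero in this set. -/
theorem exists_common_zero {r : ℕ} (S : Finset ℂ) (v : Fin r → ℂ → ℂ) {m : ℕ}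
    (hm : S.card * r < m) (h : ∀ t : Fin m, ∃ z ∈ S, ∑ i : Fin r, ((t : ℕ) : ℂ) ^ (i : ℕ) * v i z = 0) :
    ∃ z ∈ S, ∀ i, v i z = 0 := by
  classical
  -- By pigeonhole, more than `r` values of `t` share one zero `z`. The polynomial in `t` with
  -- coefficients `v i z` has degree below `r`, so it vanishes identically.
  choose α hα h using h
  obtain ⟨z, hz, hc⟩ := Finset.exists_lt_card_fiber_of_mul_lt_card_of_maps_to
    (s := Finset.univ) (t := S) (f := α) (n := r) (fun t _ => hα t) (by simpa using hm)
  refine ⟨z, hz, ?_⟩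
  set T : Finset ℂ := (Finset.univ.filter fun t => α t = z).image fun t : Fin m => ((t : ℕ) : ℂ)
  have hT : r < T.card := by
    rwa [Finset.card_image_of_injective]
    exact fun a b e => Fin.ext (Nat.cast_injective e)
  have h0 : truncPoly (fun i => v i z) = 0 := by
    refine Polynomial.eq_zero_of_degree_lt_of_eval_finset_eq_zero T
      ((degree_truncPoly_lt _).trans (by exact_mod_cast hT)) fun t ht => ?_
    obtain ⟨t, ht', rfl⟩ := Finset.mem_image.1 ht
    rw [eval_truncPoly, ← h t, (Finset.mem_filter.1 ht').2]
    exact Finset.sum_congr rfl fun i _ => mul_comm _ _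
  intro i
  have h1 := congrArg (fun p => p.coeff (i : ℕ)) h0
  simp only [truncPoly, Polynomial.finsetSum_coeff, Polynomial.coeff_C_mul, Polynomial.coeff_X_pow,
    Polynomial.coeff_zero] at h1
  rw [Finset.sum_eq_single i] at h1
  · simpa using h1
  · intro j _ hj
    rw [if_neg, mul_zero]
    exact fun e => hj (Fin.ext e.symm)
  · simp

/-! ### Isolated zeros -/

/-- Otherwise all `g i` vanish on the whole `x_0`-axis and the zero is not isolated. Hence some `g
i` is regular in `x_0` without any change of coordinates. -/
theorem exists_coeff_single_ne_zero {n r : ℕ} (g : Fin r → Conv (Fin (n + 1)))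
    (hg : ∀ᶠ x : Fin (n + 1) → ℂ in 𝓝[≠] 0, ∃ i, Conv.eval (g i) x ≠ 0) :
    ∃ i k, MvPowerSeries.coeff (Finsupp.single 0 k) (g i).1 ≠ 0 := by
  by_contra! hc
  have h1 (i : Fin r) (z : ℂ) : Conv.eval (g i) (Fin.cons z 0 : Fin (n + 1) → ℂ) = 0 := by
    refine (tsum_congr fun ν => ?_).trans tsum_zero
    by_cases h2 : ν.tail = 0
    · rw [← Finsupp.cons_tail ν, h2, Finsupp.cons_zero_eq_single_zero, hc, zero_mul]
    · obtain ⟨j, hj⟩ := DFunLike.ne_iff.1 h2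
      rw [Finset.prod_eq_zero (Finset.mem_univ j.succ), mul_zero]
      simpa [Finsupp.tail_apply] using hj
  have h2 : Tendsto (fun z : ℂ => (Fin.cons z 0 : Fin (n + 1) → ℂ)) (𝓝[≠] 0) (𝓝[≠] 0) := by
    refine tendsto_nhdsWithin_iff.2 ⟨?_, ?_⟩
    · have h3 : Continuous fun z : ℂ => (Fin.cons z 0 : Fin (n + 1) → ℂ) :=
        continuous_pi fun i => by
          cases i using Fin.cases with
          | zero => exact continuous_id
          | succ i => exact continuous_const
      have h4 : (Fin.cons 0 0 : Fin (n + 1) → ℂ) = 0 := by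
        ext i
        cases i using Fin.cases <;> rfl
      have h5 := h3.tendsto 0
      rw [h4] at h5
      exact h5.mono_left nhdsWithin_le_nhds
    · filter_upwards [self_mem_nhdsWithin] with z hz e
      exact hz (congrFun e 0)
  obtain ⟨z, i, hz⟩ := (h2.eventually hg).exists
  exact hz (h1 i z)

theorem coeff_single_sum_incl {n d : ℕ} (a : Fin d → Conv (Fin n)) (j : ℕ) :
    MvPowerSeries.coeff (Finsupp.single 0 j)
      (∑ k, Conv.incl n (a k) * Conv.X 0 ^ (k : ℕ) : Conv (Fin (n + 1))).1 =
      if h : j < d then MvPowerSeries.constantCoeff (a ⟨j, h⟩).1 else 0 := by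
  classical
  push_cast
  rw [map_sum]
  have h1 (k : Fin d) : MvPowerSeries.coeff (Finsupp.single 0 j)
      ((Conv.incl n (a k)).1 * (Conv.X 0 : Conv (Fin (n + 1))).1 ^ (k : ℕ)) =
      if (k : ℕ) = j then MvPowerSeries.constantCoeff (a k).1 else 0 := by
    have h2 : ((Conv.X 0 : Conv (Fin (n + 1))).1) = MvPowerSeries.X 0 := rfl
    rw [h2, MvPowerSeries.X_pow_eq, MvPowerSeries.coeff_mul_monomial, coeff_incl, mul_one,
      ← ite_and]
    refine if_ctx_congr ?_ (fun e => ?_) fun _ => rfl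
    · simp
      omega
    · rw [e, tsub_self]
      have h3 : (0 : Fin (n + 1) →₀ ℕ).tail = 0 := by
        ext i
        simp [Finsupp.tail_apply]
      rw [h3, MvPowerSeries.coeff_zero_eq_constantCoeff_apply]
  rw [Finset.sum_congr rfl fun k _ => h1 k]
  split_ifs with h
  · rw [Finset.sum_eq_single ⟨j, h⟩]
    · simp
    · intro k _ hk
      rw [if_neg]
      exact fun e => hk (Fin.ext e)
    · simp
  · refine Finset.sum_eq_zero fun k _ => if_neg ?_
    omega

/-- A pure power of `x_0` only splits into pure powers of `x_0`, and those of `g` start at exponent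
`d`. Comparing coefficients in the division of `x_0^d` then shows that the remainder vanishes at `0`
and the quotient is a unit. -/
theorem coeff_single_mul_of_low {n d : ℕ} (q g : MvPowerSeries (Fin (n + 1)) ℂ)
    (hlow : ∀ k < d, MvPowerSeries.coeff (Finsupp.single 0 k) g = 0) {j : ℕ} (hj : j ≤ d) :
    MvPowerSeries.coeff (Finsupp.single 0 j) (q * g) =
      MvPowerSeries.constantCoeff q * MvPowerSeries.coeff (Finsupp.single 0 j) g := by
  classical
  rw [MvPowerSeries.coeff_mul, Finset.sum_eq_single (0, Finsupp.single 0 j)]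
  · rw [MvPowerSeries.coeff_zero_eq_constantCoeff_apply]
  · rintro ⟨a, b⟩ hab hne
    have hab : a + b = Finsupp.single 0 j := Finset.HasAntidiagonal.mem_antidiagonal.1 hab
    have hb : b = Finsupp.single 0 (b 0) := by
      ext i
      by_cases hi : i = 0
      · subst hi; simp
      · have := DFunLike.congr_fun hab i
        rw [Finsupp.add_apply, Finsupp.single_eq_of_ne hi] at this
        rw [Finsupp.single_eq_of_ne hi]
        omega
    have ha : a = Finsupp.single 0 (a 0) := by
      ext i
      by_cases hi : i = 0
      · subst hi; simp
      · have := DFunLike.congr_fun hab i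
        rw [Finsupp.add_apply, Finsupp.single_eq_of_ne hi] at this
        rw [Finsupp.single_eq_of_ne hi]
        omega
    have h0 := DFunLike.congr_fun hab 0
    rw [Finsupp.add_apply, Finsupp.single_eq_same] at h0
    rw [hb, hlow, mul_zero]
    by_contra hd
    have ha0 : a 0 = 0 := by omega
    refine hne (Prod.ext ?_ ?_)
    · dsimp only
      rw [ha, ha0, Finsupp.single_zero]
    · dsimp only
      rw [hb]
      congr 1
      omega
  · simp [Finset.HasAntidiagonal.mem_antidiagonal]

theorem sum_incl_mem_absConv {n d : ℕ} {a : Fin d → Conv (Fin n)} {y : Fin n → ℂ}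
    (ha : ∀ k, a k ∈ AbsConv y) (z : ℂ) :
    ∑ k, Conv.incl n (a k) * Conv.X 0 ^ (k : ℕ) ∈ AbsConv (Fin.cons z y : Fin (n + 1) → ℂ) :=
  Subalgebra.sum_mem _ fun k _ => Subalgebra.mul_mem _ (incl_mem_absConv (ha k) z)
    (Subalgebra.pow_mem _ (X_mem_absConv _ _) _)

theorem eval_sum_incl {n d : ℕ} {a : Fin d → Conv (Fin n)} {y : Fin n → ℂ}
    (ha : ∀ k, a k ∈ AbsConv y) (z : ℂ) :
    Conv.eval (∑ k, Conv.incl n (a k) * Conv.X 0 ^ (k : ℕ)) (Fin.cons z y : Fin (n + 1) → ℂ) =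
      ∑ k, Conv.eval (a k) y * z ^ (k : ℕ) := by
  have h1 := map_sum (evalHom (Fin.cons z y : Fin (n + 1) → ℂ))
    (fun k : Fin d => (⟨_, incl_mem_absConv (ha k) z⟩ : AbsConv (Fin.cons z y : Fin (n + 1) → ℂ)) *
      ⟨Conv.X 0, X_mem_absConv 0 _⟩ ^ (k : ℕ)) Finset.univ
  simp only [map_mul, map_pow, evalHom_apply, eval_incl, eval_X, Fin.cons_zero] at h1
  rw [← h1]
  push_cast
  rfl

theorem eval_elimination {n d : ℕ} {w b : Fin d → Conv (Fin n)} {y : Fin n → ℂ}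
    (hw : ∀ k, w k ∈ AbsConv y) (hb : ∀ k, b k ∈ AbsConv y) :
    Conv.eval (elimination w b) y =
      elimination (fun k => Conv.eval (w k) y) fun k => Conv.eval (b k) y := by
  have h1 := map_elimination (R := AbsConv y) (S := Conv (Fin n))
    (AbsConv y).val.toRingHom (fun k => ⟨w k, hw k⟩) fun k => ⟨b k, hb k⟩
  have h2 := map_elimination (R := AbsConv y) (evalHom y) (fun k => ⟨w k, hw k⟩) fun k => ⟨b k, hb k⟩
  exact (congrArg (fun f => Conv.eval f y) h1).trans h2.symm

theorem cons_ne_zero_of_ne {n : ℕ} {y : Fin n → ℂ} (hy : y ≠ 0) (z : ℂ) :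
    (Fin.cons z y : Fin (n + 1) → ℂ) ≠ 0 := by
  intro e
  refine hy (funext fun i => ?_)
  simpa using congrFun e i.succ

theorem norm_cons_lt {n : ℕ} {y : Fin n → ℂ} {z : ℂ} {ε : ℝ} (hy : ‖y‖ < ε) (hz : ‖z‖ < ε) :
    ‖(Fin.cons z y : Fin (n + 1) → ℂ)‖ < ε := by
  rw [pi_norm_lt_iff ((norm_nonneg z).trans_lt hz)]
  intro i
  cases i using Fin.cases with
  | zero => exact hz
  | succ i => exact (norm_le_pi_norm y i).trans_lt hy

/-- The elimination of the variable `x_0` from a system of equations with an isolated zero leads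
to a system with an isolated zero. -/
theorem eventually_exists_elimination_ne_zero {n r d : ℕ} (g : Fin r → Conv (Fin (n + 1)))
    (hg : ∀ᶠ x : Fin (n + 1) → ℂ in 𝓝[≠] 0, ∃ i, Conv.eval (g i) x ≠ 0) (i₀ : Fin r)
    (w : Fin d → Conv (Fin n)) (qw : Conv (Fin (n + 1)))
    (hw : Conv.X 0 ^ d = ∑ k, Conv.incl n (w k) * Conv.X 0 ^ (k : ℕ) + qw * g i₀)
    (hw0 : ∀ k, MvPowerSeries.constantCoeff (w k).1 = 0)
    (hqw : MvPowerSeries.constantCoeff qw.1 ≠ 0)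
    (b : Fin r → Fin d → Conv (Fin n)) (q : Fin r → Conv (Fin (n + 1)))
    (hb : ∀ i, g i = ∑ k, Conv.incl n (b i k) * Conv.X 0 ^ (k : ℕ) + q i * g i₀) :
    ∀ᶠ x : Fin n → ℂ in 𝓝[≠] 0, ∃ t : Fin (d * r + 1),
      Conv.eval (elimination w fun k => ∑ i : Fin r, algebraMap ℂ _ (((t : ℕ) : ℂ) ^ (i : ℕ)) * b i k)
        x ≠ 0 := by
  rw [eventually_nhdsWithin_iff] at hg
  have hE : ∀ᶠ y : Fin (n + 1) → ℂ in 𝓝 0, (y ∈ ({0} : Set (Fin (n + 1) → ℂ))ᶜ →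
      ∃ i, Conv.eval (g i) y ≠ 0) ∧ (∀ i, g i ∈ AbsConv y) ∧ (∀ i, q i ∈ AbsConv y) ∧
      qw ∈ AbsConv y ∧ Conv.eval qw y ≠ 0 := by
    filter_upwards [hg, eventually_all.2 fun i => eventually_mem_absConv (g i),
      eventually_all.2 fun i => eventually_mem_absConv (q i), eventually_mem_absConv qw,
      (tendsto_eval_zero qw).eventually_ne hqw] with y h1 h2 h3 h4 h5
    exact ⟨h1, h2, h3, h4, h5⟩
  obtain ⟨ε', hε', hE⟩ := Metric.eventually_nhds_iff_ball.1 hE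
  -- The root bound requires a radius at most `1`.
  set ε := min ε' 1 with hε
  have hε0 : 0 < ε := lt_min hε' one_pos
  have hsmall : ∀ᶠ x : Fin n → ℂ in 𝓝 0, ∑ k, ‖Conv.eval (w k) x‖ < ε ^ d := by
    have h1 : Tendsto (fun x : Fin n → ℂ => ∑ k, ‖Conv.eval (w k) x‖) (𝓝 0) (𝓝 0) := by
      have h2 := tendsto_finsetSum (Finset.univ : Finset (Fin d)) fun k _ =>
        (tendsto_eval_zero (w k)).norm
      simpa [hw0] using h2
    exact h1.eventually_lt_const (by positivity)
  rw [eventually_nhdsWithin_iff]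
  filter_upwards [hsmall, Metric.ball_mem_nhds _ hε0,
    eventually_all.2 fun k => eventually_mem_absConv (w k),
    eventually_all.2 fun i => eventually_all.2 fun k => eventually_mem_absConv (b i k)]
    with x hxs hxε hwx hbx hx0
  -- If all eliminants vanish at `x ≠ 0`, all remainders `∑ b_ik z^k` share a root `z` of the
  -- Weierstrass polynomial. Then `(z, x)` is a common zero of the `g i` near `0`, contradicting
  -- isolatedness.
  by_contra! hc
  rw [mem_ball_zero_iff] at hxε
  set P : Polynomial ℂ := Polynomial.X ^ d - truncPoly fun k => Conv.eval (w k) x with hP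
  have hPd : P.natDegree ≤ d := (Polynomial.natDegree_sub_le _ _).trans
    (max_le (Polynomial.natDegree_X_pow_le d) (natDegree_truncPoly_le _))
  -- This count explains the `d * r + 1` values of `t`: there are at most `d` roots.
  have hcard : P.roots.toFinset.card * r < d * r + 1 :=
    Nat.lt_succ_of_le (Nat.mul_le_mul_right r
      ((Multiset.toFinset_card_le _).trans ((Polynomial.card_roots' P).trans hPd)))
  obtain ⟨z, hz, hvz⟩ := exists_common_zero P.roots.toFinset
    (fun i z => ∑ k, Conv.eval (b i k) x * z ^ (k : ℕ)) hcard fun t => by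
      have hmem (k : Fin d) :
          ∑ i : Fin r, algebraMap ℂ (Conv (Fin n)) (((t : ℕ) : ℂ) ^ (i : ℕ)) * b i k ∈ AbsConv x :=
        Subalgebra.sum_mem _ fun i _ =>
          Subalgebra.mul_mem _ (Subalgebra.algebraMap_mem _ _) (hbx i k)
      have h1 := hc t
      rw [eval_elimination hwx hmem] at h1
      obtain ⟨z, hz, h2⟩ := exists_root_of_elimination_eq_zero h1
      refine ⟨z, Multiset.mem_toFinset.2 hz, ?_⟩
      have h3 (k : Fin d) :
          Conv.eval (∑ i : Fin r, algebraMap ℂ (Conv (Fin n)) (((t : ℕ) : ℂ) ^ (i : ℕ)) * b i k) x =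
          ∑ i : Fin r, ((t : ℕ) : ℂ) ^ (i : ℕ) * Conv.eval (b i k) x := by
        have h4 := map_sum (evalHom x) (fun i : Fin r =>
          (⟨_, Subalgebra.algebraMap_mem (AbsConv x) (((t : ℕ) : ℂ) ^ (i : ℕ))⟩ : AbsConv x) *
            ⟨b i k, hbx i k⟩) Finset.univ
        simp only [map_mul, evalHom_apply, eval_C] at h4
        rw [← h4]
        push_cast
        rfl
      simp only [h3, Finset.sum_mul] at h2
      rw [Finset.sum_comm] at h2
      rw [← h2]
      refine Finset.sum_congr rfl fun i _ => ?_
      rw [Finset.mul_sum]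
      exact Finset.sum_congr rfl fun k _ => (mul_assoc _ _ _).symm
  have hroot : z ^ d = ∑ k, Conv.eval (w k) x * z ^ (k : ℕ) := by
    have h1 := (Polynomial.mem_roots'.1 (Multiset.mem_toFinset.1 hz)).2
    rw [Polynomial.IsRoot, hP, Polynomial.eval_sub, Polynomial.eval_pow, Polynomial.eval_X,
      eval_truncPoly, sub_eq_zero] at h1
    exact h1
  have hzε : ‖z‖ < ε := norm_lt_of_mem_roots hε0 (min_le_right _ _) hxs hroot
  obtain ⟨h1, hgy, hqy, hqwy, hqw0⟩ := hE (Fin.cons z x : Fin (n + 1) → ℂ)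
    (mem_ball_zero_iff.2 ((norm_cons_lt hxε hzε).trans_le (min_le_left _ _)))
  obtain ⟨i, hi⟩ := h1 (cons_ne_zero_of_ne hx0 z)
  -- At a root of the Weierstrass polynomial the division of `x_0^d` leaves `qw * g i₀ = 0`, and
  -- `qw` is nonzero there.
  have hg0 : Conv.eval (g i₀) (Fin.cons z x : Fin (n + 1) → ℂ) = 0 := by
    have h2 := congrArg (fun f => Conv.eval f (Fin.cons z x : Fin (n + 1) → ℂ)) hw
    have h3 : Conv.eval (Conv.X 0 ^ d) (Fin.cons z x : Fin (n + 1) → ℂ) = z ^ d := by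
      have h4 := map_pow (evalHom (Fin.cons z x : Fin (n + 1) → ℂ))
        ⟨Conv.X 0, X_mem_absConv 0 _⟩ d
      simp only [evalHom_apply, eval_X, Fin.cons_zero] at h4
      rw [← h4]
      push_cast
      rfl
    simp only [h3] at h2
    rw [eval_add (sum_incl_mem_absConv hwx z) (Subalgebra.mul_mem _ hqwy (hgy i₀)),
      eval_mul hqwy (hgy i₀), eval_sum_incl hwx, hroot, left_eq_add] at h2
    exact (mul_eq_zero.1 h2).resolve_left hqw0
  refine hi ?_
  rw [hb i, eval_add (sum_incl_mem_absConv (hbx i) z) (Subalgebra.mul_mem _ (hqy i) (hgy i₀)),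
    eval_mul (hqy i) (hgy i₀), eval_sum_incl (hbx i), hg0, mul_zero, add_zero]
  exact hvz i

theorem finite_conv_fin_zero : Module.Finite ℂ (Conv (Fin 0)) := by
  refine Module.Finite.of_surjective (Algebra.linearMap ℂ (Conv (Fin 0))) fun f => ?_
  refine ⟨MvPowerSeries.coeff 0 f.1, Subtype.ext ?_⟩
  change MvPowerSeries.C _ = f.1
  ext ν
  rw [Subsingleton.elim ν 0, MvPowerSeries.coeff_zero_C]

/-- Division by `g ∈ I` makes `1, x_0, …, x_0^(d-1)` generate the quotient by `I` over the germs in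
the remaining variables, and the `e t` annihilate it. So it is an image of `d` copies of a
finite-dimensional algebra. -/
theorem finite_quotient_of_division {n d : ℕ} {ι : Type} (I : Ideal (Conv (Fin (n + 1))))
    (g : Conv (Fin (n + 1))) (hgI : g ∈ I)
    (hdiv : ∀ f : Conv (Fin (n + 1)), ∃ (a : Fin d → Conv (Fin n)) (q : Conv (Fin (n + 1))),
      f = ∑ k, Conv.incl n (a k) * Conv.X 0 ^ (k : ℕ) + q * g)
    (e : ι → Conv (Fin n)) (heI : ∀ t, Conv.incl n (e t) ∈ I)
    (hfin : Module.Finite ℂ (Conv (Fin n) ⧸ Ideal.span (Set.range e))) :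
    Module.Finite ℂ (Conv (Fin (n + 1)) ⧸ I) := by
  have hle (a) (ha : a ∈ Ideal.span (Set.range e)) :
      ((Ideal.Quotient.mkₐ ℂ I).comp (Conv.incl n)) a = 0 := by
    have h1 : Ideal.span (Set.range e) ≤ I.comap (Conv.incl n) :=
      Ideal.span_le.2 (by rintro _ ⟨t, rfl⟩; exact heI t)
    exact Ideal.Quotient.eq_zero_iff_mem.2 (h1 ha)
  set φ := Ideal.Quotient.liftₐ (Ideal.span (Set.range e))
    ((Ideal.Quotient.mkₐ ℂ I).comp (Conv.incl n)) hle with hφ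
  set ψ : (Fin d → Conv (Fin n) ⧸ Ideal.span (Set.range e)) →ₗ[ℂ] Conv (Fin (n + 1)) ⧸ I :=
    ∑ k : Fin d, (LinearMap.mulRight ℂ (Ideal.Quotient.mk I (Conv.X 0 ^ (k : ℕ)))).comp
      (φ.toLinearMap.comp (LinearMap.proj k)) with hψ
  refine Module.Finite.of_surjective ψ fun f => ?_
  obtain ⟨f, rfl⟩ := Ideal.Quotient.mk_surjective f
  obtain ⟨a, q, hf⟩ := hdiv f
  refine ⟨fun k => Ideal.Quotient.mk _ (a k), ?_⟩
  have h1 : Ideal.Quotient.mk I (q * g) = 0 := Ideal.Quotient.eq_zero_iff_mem.2 (I.mul_mem_left _ hgI)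
  rw [hf, map_add, h1, add_zero, map_sum, hψ, LinearMap.sum_apply]
  refine Finset.sum_congr rfl fun k _ => ?_
  rw [map_mul]
  rfl

/-- If the common zero of the germs `g_i` is isolated, the ideal generated by them has finite
codimension. -/
theorem finite_quotient_of_isolated_zero (n : ℕ) : ∀ {r : ℕ} (g : Fin r → Conv (Fin n)),
    (∀ᶠ x : Fin n → ℂ in 𝓝[≠] 0, ∃ i, Conv.eval (g i) x ≠ 0) →
    Module.Finite ℂ (Conv (Fin n) ⧸ Ideal.span (Set.range g)) := by
  induction n with
  | zero =>
    intro r g _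
    have := finite_conv_fin_zero
    exact Module.Finite.of_surjective (Ideal.Quotient.mkₐ ℂ _).toLinearMap
      (Ideal.Quotient.mkₐ_surjective ℂ _)
  | succ n ih =>
    intro r g hg
    classical
    obtain ⟨i₀, hi₀⟩ := exists_coeff_single_ne_zero g hg
    set d := Nat.find hi₀ with hd
    have hd0 : MvPowerSeries.coeff (Finsupp.single 0 d) (g i₀).1 ≠ 0 := Nat.find_spec hi₀
    have hlow (k : ℕ) (hk : k < d) : MvPowerSeries.coeff (Finsupp.single 0 k) (g i₀).1 = 0 :=
      not_not.1 (Nat.find_min hi₀ hk)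
    have hdiv := exists_weierstrass_division (g i₀) hlow hd0
    -- Dividing `x_0^d` itself produces the Weierstrass polynomial associated with `g i₀`.
    obtain ⟨w, qw, hw⟩ := hdiv (Conv.X 0 ^ d)
    choose b q hb using fun i => hdiv (g i)
    have hcoef (j : ℕ) (hj : j ≤ d) :
        MvPowerSeries.coeff (Finsupp.single 0 j) (Conv.X 0 ^ d : Conv (Fin (n + 1))).1 =
        (if h : j < d then MvPowerSeries.constantCoeff (w ⟨j, h⟩).1 else 0) +
          MvPowerSeries.constantCoeff qw.1 *
            MvPowerSeries.coeff (Finsupp.single 0 j) (g i₀).1 := by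
      rw [hw, ← coeff_single_sum_incl, ← coeff_single_mul_of_low qw.1 (g i₀).1 hlow hj, ← map_add]
      rfl
    have hX (j : ℕ) :
        MvPowerSeries.coeff (Finsupp.single 0 j) (Conv.X 0 ^ d : Conv (Fin (n + 1))).1 =
        if j = d then 1 else 0 := by
      have h1 : (Conv.X 0 ^ d : Conv (Fin (n + 1))).1 = MvPowerSeries.X 0 ^ d := rfl
      rw [h1, MvPowerSeries.coeff_X_pow]
      refine if_congr ⟨fun e => Finsupp.single_injective 0 e, fun e => by rw [e]⟩ rfl rfl
    have hw0 (k : Fin d) : MvPowerSeries.constantCoeff (w k).1 = 0 := by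
      have h1 := hcoef k k.2.le
      rw [hX, if_neg k.2.ne, dif_pos k.2, hlow k k.2, mul_zero, add_zero] at h1
      exact h1.symm
    have hqw : MvPowerSeries.constantCoeff qw.1 ≠ 0 := by
      intro h0
      have h1 := hcoef d le_rfl
      rw [hX, if_pos rfl, dif_neg (lt_irrefl d), h0, zero_mul, zero_add] at h1
      exact one_ne_zero h1
    have hgI (i : Fin r) : g i ∈ Ideal.span (Set.range g) := Ideal.subset_span ⟨i, rfl⟩
    refine finite_quotient_of_division _ (g i₀) (hgI i₀) hdiv _ (fun t => ?_)
      (ih _ (eventually_exists_elimination_ne_zero g hg i₀ w qw hw hw0 hqw b q hb))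
    obtain ⟨u, v, huv⟩ := exists_map_elimination_eq (Conv.incl n).toRingHom w
      (fun k => ∑ i : Fin r, algebraMap ℂ _ (((t : ℕ) : ℂ) ^ (i : ℕ)) * b i k) (Conv.X 0)
    have h1 : Conv.X 0 ^ d - ∑ k, Conv.incl n (w k) * Conv.X 0 ^ (k : ℕ) = qw * g i₀ :=
      sub_eq_of_eq_add' hw
    have h2 : ∑ k, Conv.incl n (∑ i : Fin r, algebraMap ℂ _ (((t : ℕ) : ℂ) ^ (i : ℕ)) * b i k) *
        Conv.X 0 ^ (k : ℕ) =
        ∑ i : Fin r, algebraMap ℂ _ (((t : ℕ) : ℂ) ^ (i : ℕ)) * (g i - q i * g i₀) := by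
      have h3 (i : Fin r) : g i - q i * g i₀ =
          ∑ k, Conv.incl n (b i k) * Conv.X 0 ^ (k : ℕ) := sub_eq_of_eq_add (hb i)
      simp only [h3, map_sum, map_mul, AlgHom.commutes, Finset.sum_mul, Finset.mul_sum, mul_assoc]
      exact Finset.sum_comm
    change (Conv.incl n).toRingHom _ ∈ _
    rw [huv]
    -- The two polynomials at `x_0` are `qw * g i₀` and a combination of the `g i - q i * g i₀`, all
    -- in the ideal.
    refine Ideal.add_mem _ (Ideal.mul_mem_right u _ ?_) (Ideal.mul_mem_right v _ ?_)
    · refine (congrArg (· ∈ Ideal.span (Set.range g)) h1).mpr ?_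
      exact Ideal.mul_mem_left _ _ (hgI i₀)
    · refine (congrArg (· ∈ Ideal.span (Set.range g)) h2).mpr ?_
      exact Ideal.sum_mem _ fun i _ => Ideal.mul_mem_left _ _
        (Ideal.sub_mem _ (hgI i) (Ideal.mul_mem_left _ _ (hgI i₀)))

/-! ### The Koszul complex -/

section Koszul

open scoped Pointwise

/-- The module underlying the Koszul complex `M ⊗ Λ(e_0, …, e_{n-1})`; the pair `(α, β)`
stands for `α + e_0 ∧ β`. -/
def Kos (M : Type) : ℕ → Type
  | 0 => M
  | n + 1 => Kos M n × Kos M n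

instance kosAddCommGroup (M : Type) [AddCommGroup M] : ∀ n, AddCommGroup (Kos M n)
  | 0 => inferInstanceAs (AddCommGroup M)
  | n + 1 =>
    letI := kosAddCommGroup M n
    inferInstanceAs (AddCommGroup (Kos M n × Kos M n))

instance kosModule (R M : Type) [CommRing R] [AddCommGroup M] [Module R M] :
    ∀ n, Module R (Kos M n)
  | 0 => inferInstanceAs (Module R M)
  | n + 1 =>
    letI := kosModule R M n
    inferInstanceAs (Module R (Kos M n × Kos M n))

variable {R M N : Type} [CommRing R] [AddCommGroup M] [Module R M] [AddCommGroup N] [Module R N]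

/-- The Koszul differential: contraction with `g`. -/
def kosD : (n : ℕ) → (Fin n → R) → Kos M n →ₗ[R] Kos M n
  | 0, _ => 0
  | n + 1, g => LinearMap.prod (M₂ := Kos M n) (M₃ := Kos M n)
      ((kosD n (Fin.tail g)).comp (LinearMap.fst R (Kos M n) (Kos M n)) +
        g 0 • LinearMap.snd R (Kos M n) (Kos M n))
      (-(kosD n (Fin.tail g)).comp (LinearMap.snd R (Kos M n) (Kos M n)))

/-- Exterior multiplication by `c`. -/
def kosH : (n : ℕ) → (Fin n → R) → Kos M n →ₗ[R] Kos M n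
  | 0, _ => 0
  | n + 1, c => LinearMap.prod (M₂ := Kos M n) (M₃ := Kos M n)
      ((kosH n (Fin.tail c)).comp (LinearMap.fst R (Kos M n) (Kos M n)))
      (c 0 • LinearMap.fst R (Kos M n) (Kos M n) -
        (kosH n (Fin.tail c)).comp (LinearMap.snd R (Kos M n) (Kos M n)))

theorem kosD_succ {n : ℕ} (g : Fin (n + 1) → R) (α β : Kos M n) :
    kosD (n + 1) g ((α, β) : Kos M n × Kos M n) =
      ((kosD n (Fin.tail g) α + g 0 • β, -kosD n (Fin.tail g) β) : Kos M n × Kos M n) := rfl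

theorem kosH_succ {n : ℕ} (c : Fin (n + 1) → R) (α β : Kos M n) :
    kosH (n + 1) c ((α, β) : Kos M n × Kos M n) =
      ((kosH n (Fin.tail c) α, c 0 • α - kosH n (Fin.tail c) β) : Kos M n × Kos M n) := rfl

/-- This homotopy formula shows that every element `∑ c_i g_i` of the ideal kills the Koszul
homology. -/
theorem kosD_kosH_add {n : ℕ} (g c : Fin n → R) (ω : Kos M n) :
    kosD n g (kosH n c ω) + kosH n c (kosD n g ω) = (∑ i, c i * g i) • ω := by
  induction n with
  | zero =>
    change (0 : M) + 0 = _
    simp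
    rfl
  | succ n ih =>
    obtain ⟨α, β⟩ := ω
    have h1 := ih (Fin.tail g) (Fin.tail c) α
    have h2 := ih (Fin.tail g) (Fin.tail c) β
    rw [kosD_succ, kosH_succ, kosD_succ, kosH_succ, Fin.sum_univ_succ]
    refine Prod.ext ?_ ?_
    · change kosD n (Fin.tail g) (kosH n (Fin.tail c) α) +
        g 0 • (c 0 • α - kosH n (Fin.tail c) β) +
        kosH n (Fin.tail c) (kosD n (Fin.tail g) α + g 0 • β) =
        (c 0 * g 0 + ∑ i, Fin.tail c i * Fin.tail g i) • α
      rw [add_smul, ← h1, map_add, map_smul, smul_sub, smul_smul, mul_comm (g 0)]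
      abel
    · change -kosD n (Fin.tail g) (c 0 • α - kosH n (Fin.tail c) β) +
        (c 0 • (kosD n (Fin.tail g) α + g 0 • β) - kosH n (Fin.tail c) (-kosD n (Fin.tail g) β)) =
        (c 0 * g 0 + ∑ i, Fin.tail c i * Fin.tail g i) • β
      rw [add_smul, ← h2, map_sub, map_smul, map_neg, smul_add, smul_smul]
      abel

/-- The elements of degree less than `q`. -/
def kosLow (R M : Type) [CommRing R] [AddCommGroup M] [Module R M] :
    (n q : ℕ) → Submodule R (Kos M n)
  | _, 0 => ⊥
  | 0, _ + 1 => ⊤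
  | n + 1, q + 1 => Submodule.prod (M := Kos M n) (M' := Kos M n) (kosLow R M n (q + 1))
      (kosLow R M n q)

theorem kosLow_eq_top {n q : ℕ} (h : n < q) : kosLow R M n q = ⊤ := by
  induction n generalizing q with
  | zero =>
    obtain ⟨q, rfl⟩ := Nat.exists_eq_succ_of_ne_zero h.ne'
    rfl
  | succ n ih =>
    obtain ⟨q, rfl⟩ := Nat.exists_eq_succ_of_ne_zero (Nat.ne_zero_of_lt h)
    change Submodule.prod (kosLow R M n (q + 1)) (kosLow R M n q) = ⊤
    rw [ih (by omega), ih (by omega), Submodule.prod_top]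

theorem kosD_mem_kosLow {n : ℕ} (g : Fin n → R) {q : ℕ} {ω : Kos M n} (h : ω ∈ kosLow R M n q) :
    kosD n g ω ∈ kosLow R M n (q - 1) := by
  induction n generalizing q with
  | zero => exact Submodule.zero_mem _
  | succ n ih =>
    cases q with
    | zero =>
      have h : ω ∈ (⊥ : Submodule R (Kos M (n + 1))) := h
      rw [Submodule.mem_bot] at h
      rw [h, map_zero]
      exact Submodule.zero_mem _
    | succ q =>
      obtain ⟨α, β⟩ := ω
      obtain ⟨h1, h2⟩ : α ∈ kosLow R M n (q + 1) ∧ β ∈ kosLow R M n q := h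
      rw [kosD_succ]
      have h3 := ih (Fin.tail g) h1
      have h4 := ih (Fin.tail g) h2
      rw [Nat.add_sub_cancel] at h3 ⊢
      cases q with
      | zero =>
        have h2 : β ∈ (⊥ : Submodule R (Kos M n)) := by cases n <;> exact h2
        have h3 : kosD n (Fin.tail g) α ∈ (⊥ : Submodule R (Kos M n)) := by cases n <;> exact h3
        rw [Submodule.mem_bot] at h2 h3
        refine (Submodule.mem_bot R).2 (Prod.ext ?_ ?_)
        · change kosD n (Fin.tail g) α + g 0 • β = 0
          rw [h2, h3, smul_zero, add_zero]
        · change -kosD n (Fin.tail g) β = 0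
          rw [h2, map_zero, neg_zero]
      | succ q =>
        exact ⟨Submodule.add_mem _ h3 (Submodule.smul_mem _ _ h2), Submodule.neg_mem _ h4⟩

theorem kos_isSMulRegular {a : R} (ha : IsSMulRegular M a) (n : ℕ) : IsSMulRegular (Kos M n) a := by
  induction n with
  | zero => exact ha
  | succ n ih =>
    rintro ⟨α, β⟩ ⟨α', β'⟩ h
    exact Prod.ext (ih (congrArg Prod.fst h)) (ih (congrArg Prod.snd h))

theorem mem_kosLow_of_smul_mem {a : R} (ha : IsSMulRegular M a) {n q : ℕ} {ω : Kos M n}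
    (h : a • ω ∈ kosLow R M n q) : ω ∈ kosLow R M n q := by
  induction n generalizing q with
  | zero =>
    cases q with
    | zero =>
      have h : a • ω ∈ (⊥ : Submodule R (Kos M 0)) := h
      change ω ∈ (⊥ : Submodule R (Kos M 0))
      rw [Submodule.mem_bot] at h ⊢
      exact kos_isSMulRegular ha 0 (h.trans (smul_zero a).symm)
    | succ q => exact Submodule.mem_top
  | succ n ih =>
    cases q with
    | zero =>
      have h : a • ω ∈ (⊥ : Submodule R (Kos M (n + 1))) := h
      change ω ∈ (⊥ : Submodule R (Kos M (n + 1)))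
      rw [Submodule.mem_bot] at h ⊢
      exact kos_isSMulRegular ha (n + 1) (h.trans (smul_zero a).symm)
    | succ q =>
      obtain ⟨α, β⟩ := ω
      exact ⟨ih h.1, ih h.2⟩

/-- The functoriality of the Koszul complex. -/
def kosMap (φ : M →ₗ[R] N) : (n : ℕ) → Kos M n →ₗ[R] Kos N n
  | 0 => φ
  | n + 1 => LinearMap.prodMap (M := Kos M n) (M₂ := Kos M n) (M₃ := Kos N n) (M₄ := Kos N n)
      (kosMap φ n) (kosMap φ n)

theorem kosMap_kosD (φ : M →ₗ[R] N) {n : ℕ} (g : Fin n → R) (ω : Kos M n) :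
    kosMap φ n (kosD n g ω) = kosD n g (kosMap φ n ω) := by
  induction n with
  | zero => exact map_zero φ
  | succ n ih =>
    obtain ⟨α, β⟩ := ω
    refine Prod.ext ?_ ?_
    · change kosMap φ n (kosD n (Fin.tail g) α + g 0 • β) =
        kosD n (Fin.tail g) (kosMap φ n α) + g 0 • kosMap φ n β
      rw [map_add, map_smul, ih]
    · change kosMap φ n (-kosD n (Fin.tail g) β) = -kosD n (Fin.tail g) (kosMap φ n β)
      rw [map_neg, ih]

theorem exists_kosMap_eq_of_mem_kosLow {φ : M →ₗ[R] N} (hφ : Function.Surjective φ) {n q : ℕ}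
    {ω : Kos N n} (h : ω ∈ kosLow R N n q) : ∃ η ∈ kosLow R M n q, kosMap φ n η = ω := by
  induction n generalizing q with
  | zero =>
    cases q with
    | zero =>
      have h : ω ∈ (⊥ : Submodule R (Kos N 0)) := h
      rw [Submodule.mem_bot] at h
      exact ⟨0, Submodule.zero_mem _, by rw [h, map_zero]⟩
    | succ q =>
      obtain ⟨η, hη⟩ := hφ ω
      exact ⟨η, Submodule.mem_top, hη⟩
  | succ n ih =>
    cases q with
    | zero =>
      have h : ω ∈ (⊥ : Submodule R (Kos N (n + 1))) := h
      rw [Submodule.mem_bot] at h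
      exact ⟨0, Submodule.zero_mem _, by rw [h, map_zero]⟩
    | succ q =>
      obtain ⟨α, β⟩ := ω
      obtain ⟨α', hα, rfl⟩ := ih h.1
      obtain ⟨β', hβ, rfl⟩ := ih h.2
      exact ⟨(α', β'), ⟨hα, hβ⟩, rfl⟩

theorem exists_smul_eq_of_kosMap_eq_zero {a : R} {n : ℕ} {ω : Kos M n}
    (h : kosMap (Submodule.mkQ (a • (⊤ : Submodule R M))) n ω = 0) : ∃ θ : Kos M n, ω = a • θ := by
  induction n with
  | zero =>
    have key (m : M) (hm : Submodule.mkQ (a • (⊤ : Submodule R M)) m = 0) : ∃ θ : M, m = a • θ := by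
      rw [Submodule.mkQ_apply, Submodule.Quotient.mk_eq_zero,
        Submodule.mem_smul_pointwise_iff_exists] at hm
      obtain ⟨θ, -, hθ⟩ := hm
      exact ⟨θ, hθ.symm⟩
    exact key ω h
  | succ n ih =>
    obtain ⟨α, β⟩ := ω
    obtain ⟨α', hα⟩ := ih (congrArg Prod.fst h)
    obtain ⟨β', hβ⟩ := ih (congrArg Prod.snd h)
    exact ⟨(α', β'), Prod.ext hα hβ⟩

theorem kos_smul_quotient_eq_zero (a : R) {n : ℕ} (ω : Kos (QuotSMulTop a M) n) : a • ω = 0 := by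
  induction n with
  | zero =>
    obtain ⟨m, hm⟩ := Submodule.mkQ_surjective (a • (⊤ : Submodule R M)) ω
    rw [← hm]
    change a • Submodule.mkQ (a • (⊤ : Submodule R M)) m = 0
    rw [← map_smul, Submodule.mkQ_apply, Submodule.Quotient.mk_eq_zero]
    exact Submodule.smul_mem_pointwise_smul m a ⊤ Submodule.mem_top
  | succ n ih =>
    obtain ⟨α, β⟩ := ω
    exact Prod.ext (ih α) (ih β)

/-- Depth sensitivity of the Koszul complex: if the ideal generated by `g` contains an `M`-regular
sequence of length `l`, the homology vanishes in the degrees `≥ n + 1 - l`. -/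
theorem exists_eq_kosD_add_of_isWeaklyRegular {n : ℕ} (g : Fin n → R) (rs : List R)
    (hrs : RingTheory.Sequence.IsWeaklyRegular M rs)
    (hg : ∀ a ∈ rs, a ∈ Ideal.span (Set.range g)) (ω : Kos M n) (hω : kosD n g ω = 0) :
    ∃ η, ∃ φ ∈ kosLow R M n (n + 1 - rs.length), ω = kosD n g η + φ := by
  induction rs generalizing M with
  | nil =>
    refine ⟨0, ω, ?_, by rw [map_zero, zero_add]⟩
    rw [kosLow_eq_top (by simp)]
    exact Submodule.mem_top
  | cons a rs ih =>
    rw [RingTheory.Sequence.isWeaklyRegular_cons_iff] at hrs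
    obtain ⟨c, hc⟩ := (Ideal.mem_span_range_iff_exists_fun).1 (hg a (by simp))
    -- Since `a • ω` is a boundary, `kosH n c ω` is a cycle modulo `a`, to which the induction
    -- hypothesis for `M / aM` applies.
    have h1 : kosD n g (kosH n c ω) = a • ω := by
      rw [← hc, ← kosD_kosH_add g c ω, hω, map_zero, add_zero]
    set π := Submodule.mkQ (a • (⊤ : Submodule R M)) with hπ
    have h2 : kosD n g (kosMap π n (kosH n c ω)) = 0 := by
      rw [← kosMap_kosD, h1, map_smul]
      exact kos_smul_quotient_eq_zero a _
    obtain ⟨η', φ', hφ', h3⟩ := ih (M := QuotSMulTop a M) hrs.2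
      (fun b hb => hg b (by simp [hb])) _ h2
    have hsurj : Function.Surjective π := Submodule.mkQ_surjective _
    obtain ⟨φ, hφ, rfl⟩ := exists_kosMap_eq_of_mem_kosLow hsurj hφ'
    obtain ⟨η, -, rfl⟩ := exists_kosMap_eq_of_mem_kosLow (q := n + 1) hsurj (ω := η') (by
      rw [kosLow_eq_top (Nat.lt_succ_self n)]
      exact Submodule.mem_top)
    have h4 : kosMap π n (kosH n c ω - kosD n g η - φ) = 0 := by
      rw [map_sub, map_sub, h3, kosMap_kosD]
      abel
    obtain ⟨θ, hθ⟩ := exists_smul_eq_of_kosMap_eq_zero h4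
    have hDD : kosD n g (kosD n g η) = 0 := by
      clear * -
      induction n with
      | zero => rfl
      | succ n ih =>
        obtain ⟨α, β⟩ := η
        rw [kosD_succ, kosD_succ, map_add, map_smul, map_neg, ih, ih]
        simp
        rfl
    -- Lifting gives `kosH n c ω = kosD n g η + φ + a • θ` with `φ` of low degree. The differential
    -- lowers the degree bound of `φ` by one more, and regularity of `a` transfers the bound to `ω -
    -- kosD n g θ`.
    have h5 : a • (ω - kosD n g θ) = kosD n g φ := by
      have h6 : kosH n c ω = kosD n g η + φ + a • θ := by rw [← hθ]; abel
      rw [smul_sub, ← h1, h6, map_add, map_add, hDD, map_smul]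
      abel
    refine ⟨θ, ω - kosD n g θ, ?_, by abel⟩
    refine mem_kosLow_of_smul_mem hrs.1 ?_
    rw [h5, List.length_cons, ← Nat.sub_sub]
    exact kosD_mem_kosLow g hφ

/-! ### Components of degrees 0 and 1, and relations as Koszul cycles. -/

/-- The component of degree `0`. -/
def kosZero : {n : ℕ} → Kos M n → M
  | 0, ω => ω
  | n + 1, ω => kosZero (n := n) (Prod.fst (β := Kos M n) ω)

/-- The components of degree `1`. -/
def kosOne : {n : ℕ} → Kos M n → Fin n → M
  | 0, _ => Fin.elim0
  | n + 1, ω => Fin.cons (kosZero (n := n) (Prod.snd (α := Kos M n) ω))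
      (kosOne (n := n) (Prod.fst (β := Kos M n) ω))

/-- The element of degree `0` with given component. -/
def kosOfZero (m : M) : (n : ℕ) → Kos M n
  | 0 => m
  | n + 1 => ((kosOfZero m n, 0) : Kos M n × Kos M n)

/-- The element of degree `1` with given components. -/
def kosOfOne : {n : ℕ} → (Fin n → M) → Kos M n
  | 0, _ => (0 : M)
  | n + 1, b => ((kosOfOne (Fin.tail b), kosOfZero (b 0) n) : Kos M n × Kos M n)

theorem kosZero_add {n : ℕ} (ω η : Kos M n) : kosZero (ω + η) = kosZero ω + kosZero η := by
  induction n with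
  | zero => rfl
  | succ n ih => exact ih _ _

theorem kosZero_neg {n : ℕ} (ω : Kos M n) : kosZero (-ω) = -kosZero ω := by
  induction n with
  | zero => rfl
  | succ n ih => exact ih _

theorem kosZero_smul {n : ℕ} (a : R) (ω : Kos M n) : kosZero (a • ω) = a • kosZero ω := by
  induction n with
  | zero => rfl
  | succ n ih => exact ih _

theorem kosZero_zero {n : ℕ} : kosZero (0 : Kos M n) = 0 := by
  induction n with
  | zero => rfl
  | succ n ih => exact ih

theorem kosOne_add {n : ℕ} (ω η : Kos M n) (i : Fin n) :
    kosOne (ω + η) i = kosOne ω i + kosOne η i := by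
  induction n with
  | zero => exact i.elim0
  | succ n ih =>
    cases i using Fin.cases with
    | zero => exact kosZero_add _ _
    | succ i => exact ih _ _ i

theorem kosOne_smul {n : ℕ} (a : R) (ω : Kos M n) (i : Fin n) :
    kosOne (a • ω) i = a • kosOne ω i := by
  induction n with
  | zero => exact i.elim0
  | succ n ih =>
    cases i using Fin.cases with
    | zero => exact kosZero_smul _ _
    | succ i => exact ih _ i

theorem kosZero_kosOfZero {n : ℕ} (m : M) : kosZero (kosOfZero m n) = m := by
  induction n with
  | zero => rfl
  | succ n ih => exact ih

theorem kosOne_kosOfOne {n : ℕ} (b : Fin n → M) (i : Fin n) : kosOne (kosOfOne b) i = b i := by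
  induction n with
  | zero => exact i.elim0
  | succ n ih =>
    cases i using Fin.cases with
    | zero => exact kosZero_kosOfZero _
    | succ i => exact ih _ i

theorem kosD_kosOfZero {n : ℕ} (g : Fin n → R) (m : M) : kosD n g (kosOfZero m n) = 0 := by
  induction n with
  | zero => rfl
  | succ n ih =>
    change kosD (n + 1) g ((kosOfZero m n, 0) : Kos M n × Kos M n) = 0
    rw [kosD_succ, ih, smul_zero, map_zero, neg_zero, add_zero]
    rfl

theorem kosOfZero_add {n : ℕ} (m m' : M) :
    kosOfZero (m + m') n = kosOfZero m n + kosOfZero m' n := by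
  induction n with
  | zero => rfl
  | succ n ih => exact Prod.ext ih (add_zero _).symm

theorem kosOfZero_smul {n : ℕ} (a : R) (m : M) : kosOfZero (a • m) n = a • kosOfZero m n := by
  induction n with
  | zero => rfl
  | succ n ih => exact Prod.ext ih (smul_zero _).symm

theorem kosOfZero_zero {n : ℕ} : kosOfZero (0 : M) n = 0 := by
  induction n with
  | zero => rfl
  | succ n ih => exact Prod.ext ih rfl

theorem kosD_kosOfOne {n : ℕ} (g : Fin n → R) (b : Fin n → M) :
    kosD n g (kosOfOne b) = kosOfZero (∑ i, g i • b i) n := by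
  induction n with
  | zero => rfl
  | succ n ih =>
    refine Prod.ext ?_ ?_
    · change kosD n (Fin.tail g) (kosOfOne (Fin.tail b)) + g 0 • kosOfZero (b 0) n =
        kosOfZero (∑ i, g i • b i) n
      rw [ih, Fin.sum_univ_succ, ← kosOfZero_smul, ← kosOfZero_add, add_comm]
      rfl
    · change -kosD n (Fin.tail g) (kosOfZero (b 0) n) = 0
      rw [kosD_kosOfZero, neg_zero]

theorem kosOne_eq_zero {n : ℕ} {ω : Kos M n} (h : ω ∈ kosLow R M n 1) (i : Fin n) :
    kosOne ω i = 0 := by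
  induction n with
  | zero => exact i.elim0
  | succ n ih =>
    obtain ⟨α, β⟩ := ω
    obtain ⟨h1, h2⟩ : α ∈ kosLow R M n 1 ∧ β ∈ kosLow R M n 0 := h
    cases i using Fin.cases with
    | zero =>
      have h2 : β ∈ (⊥ : Submodule R (Kos M n)) := by cases n <;> exact h2
      rw [Submodule.mem_bot] at h2
      subst h2
      exact kosZero_zero
    | succ i => exact ih h1 i

theorem kosZero_kosD {n : ℕ} (g : Fin n → R) (η : Kos M n) :
    kosZero (kosD n g η) = ∑ i, g i • kosOne η i := by
  induction n with
  | zero => rfl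
  | succ n ih =>
    obtain ⟨α, β⟩ := η
    change kosZero (kosD n (Fin.tail g) α + g 0 • β) = _
    rw [kosZero_add, ih, kosZero_smul, Fin.sum_univ_succ, add_comm]
    rfl

/-- The components of degree 2 form an alternating matrix. Writing it as `γ i k - γ k i` spares a
separate antisymmetry condition; the witness records only the entries above the diagonal. -/
theorem exists_kosOne_kosD_eq {n : ℕ} (g : Fin n → R) (η : Kos M n) :
    ∃ γ : Fin n → Fin n → M, ∀ i, kosOne (kosD n g η) i = ∑ k, g k • (γ i k - γ k i) := by
  induction n with
  | zero => exact ⟨fun i => i.elim0, fun i => i.elim0⟩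
  | succ n ih =>
    obtain ⟨α, β⟩ := η
    obtain ⟨γ, hγ⟩ := ih (Fin.tail g) α
    refine ⟨Fin.cons (Fin.cons 0 fun k => -kosOne β k) fun i => Fin.cons 0 (γ i), fun i => ?_⟩
    cases i using Fin.cases with
    | zero =>
      change kosZero (-kosD n (Fin.tail g) β) = _
      rw [kosZero_neg, kosZero_kosD, Fin.sum_univ_succ]
      simp [Fin.tail]
    | succ i =>
      change kosOne (kosD n (Fin.tail g) α + g 0 • β) i = _
      rw [kosOne_add, hγ, kosOne_smul, Fin.sum_univ_succ]
      simp [Fin.tail, add_comm]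

/-- If the ideal generated by `g_0, …, g_{n-1}` contains an `M`-regular sequence of length `n`, all
relations between the `g_i` are trivial. -/
theorem exists_alternating_of_isWeaklyRegular {n : ℕ} (g : Fin n → R) (rs : List R)
    (hrs : RingTheory.Sequence.IsWeaklyRegular M rs) (hlen : rs.length = n)
    (hg : ∀ a ∈ rs, a ∈ Ideal.span (Set.range g)) (b : Fin n → M) (hb : ∑ i, g i • b i = 0) :
    ∃ γ : Fin n → Fin n → M, ∀ i, b i = ∑ k, g k • (γ i k - γ k i) := by
  obtain ⟨η, φ, hφ, h⟩ := exists_eq_kosD_add_of_isWeaklyRegular g rs hrs hg (kosOfOne b)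
    (by rw [kosD_kosOfOne, hb, kosOfZero_zero])
  -- A sequence of full length `n` leaves an error of degree below `1`, invisible in degree 1.
  rw [hlen, Nat.add_sub_cancel_left] at hφ
  obtain ⟨γ, hγ⟩ := exists_kosOne_kosD_eq g η
  refine ⟨γ, fun i => ?_⟩
  rw [← hγ, ← kosOne_kosOfOne b i, h, kosOne_add, kosOne_eq_zero hφ, add_zero]

end Koszul

/-! ### Powers of the coordinates -/

theorem IsConvergent.shiftDown {σ : Type} {f : MvPowerSeries σ ℂ} (hf : IsConvergent f)
    (δ : σ →₀ ℕ) : IsConvergent (shiftDown δ f) := by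
  obtain ⟨r, hr, h⟩ := hf
  refine ⟨r, hr, ?_⟩
  have h1 := (h.comp_injective (add_left_injective δ)).mul_right (r ^ δ.degree)⁻¹
  refine h1.congr fun ν => ?_
  simp only [Function.comp_apply, GaussManin.shiftDown, coeff_series, map_add, pow_add]
  field_simp

/-- The germs all of whose monomials are divisible by some `x_j^k` with `j < i`. -/
def powIdeal (n k i : ℕ) : Ideal (Conv (Fin n)) where
  carrier := {f | ∀ ν : Fin n →₀ ℕ, (∀ j : Fin n, (j : ℕ) < i → ν j < k) →
    MvPowerSeries.coeff ν f.1 = 0}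
  zero_mem' ν _ := map_zero _
  add_mem' {f g} hf hg ν hν := by
    have h : MvPowerSeries.coeff ν (f + g).1 = _ := map_add _ f.1 g.1
    rw [h, hf ν hν, hg ν hν, add_zero]
  smul_mem' g f hf ν hν := by
    classical
    have h : MvPowerSeries.coeff ν (g • f).1 = _ := MvPowerSeries.coeff_mul ν g.1 f.1
    rw [h]
    refine Finset.sum_eq_zero fun p hp => ?_
    rw [hf p.2, mul_zero]
    intro j hj
    have h1 := DFunLike.congr_fun (Finset.HasAntidiagonal.mem_antidiagonal.1 hp) j
    rw [Finsupp.add_apply] at h1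
    have := hν j hj
    omega

theorem mem_powIdeal {n k i : ℕ} {f : Conv (Fin n)} : f ∈ powIdeal n k i ↔
    ∀ ν : Fin n →₀ ℕ, (∀ j : Fin n, (j : ℕ) < i → ν j < k) → MvPowerSeries.coeff ν f.1 = 0 :=
  Iff.rfl

theorem coeff_X_pow_mul {n : ℕ} (i : Fin n) (k : ℕ) (f : Conv (Fin n)) (ν : Fin n →₀ ℕ) :
    MvPowerSeries.coeff ν (Conv.X i ^ k * f).1 =
      if k ≤ ν i then MvPowerSeries.coeff (ν - Finsupp.single i k) f.1 else 0 := by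
  classical
  have h : (Conv.X i ^ k * f).1 = MvPowerSeries.monomial (Finsupp.single i k) 1 * f.1 := by
    rw [← MvPowerSeries.X_pow_eq]
    rfl
  rw [h, MvPowerSeries.coeff_monomial_mul, one_mul]
  simp only [Finsupp.single_le_iff]

theorem X_pow_mem_powIdeal {n k i : ℕ} {j : Fin n} (hj : (j : ℕ) < i) :
    Conv.X j ^ k ∈ powIdeal n k i := by
  rw [mem_powIdeal]
  intro ν hν
  rw [← mul_one (Conv.X j ^ k), coeff_X_pow_mul, if_neg (not_le.2 (hν j hj))]

theorem powIdeal_le_span {n k i : ℕ} (hi : i ≤ n) :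
    powIdeal n k i ≤ Ideal.span {g | ∃ j : Fin n, (j : ℕ) < i ∧ g = Conv.X j ^ k} := by
  induction i with
  | zero =>
    intro f hf
    have h : f = 0 := Subtype.ext (MvPowerSeries.ext fun ν => by
      rw [hf ν (fun j hj => absurd hj (Nat.not_lt_zero _))]
      exact (map_zero _).symm)
    rw [h]
    exact Ideal.zero_mem _
  | succ i ih =>
    intro f hf
    set x : Fin n := ⟨i, hi⟩ with hx
    -- Subtracting `x_i^k q` removes exactly the monomials divisible by `x_i^k`; the rest lies in
    -- the ideal of the earlier powers.
    set q : Conv (Fin n) := ⟨_, f.2.shiftDown (Finsupp.single x k)⟩ with hq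
    have h1 : f - Conv.X x ^ k * q ∈ powIdeal n k i := by
      rw [mem_powIdeal]
      intro ν hν
      have h2 : MvPowerSeries.coeff ν (f - Conv.X x ^ k * q).1 =
          MvPowerSeries.coeff ν f.1 - MvPowerSeries.coeff ν (Conv.X x ^ k * q).1 := map_sub _ _ _
      rw [h2, coeff_X_pow_mul]
      split_ifs with h3
      · have h4 : ν - Finsupp.single x k + Finsupp.single x k = ν :=
          tsub_add_cancel_of_le (by simpa using h3)
        simp only [hq, shiftDown, coeff_series, h4, sub_self]
      · rw [sub_zero]
        refine hf ν fun j hj => ?_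
        rcases Nat.lt_succ_iff_lt_or_eq.1 hj with hj | hj
        · exact hν j hj
        · have : j = x := Fin.ext hj
          rw [this]
          exact not_le.1 h3
    have hsub : {g : Conv (Fin n) | ∃ j : Fin n, (j : ℕ) < i ∧ g = Conv.X j ^ k} ⊆
        {g | ∃ j : Fin n, (j : ℕ) < i + 1 ∧ g = Conv.X j ^ k} := by
      rintro g ⟨j, hj, rfl⟩
      exact ⟨j, hj.trans (Nat.lt_succ_self i), rfl⟩
    have h2 := Ideal.span_mono hsub (ih (by omega) h1)
    have h3 : Conv.X x ^ k * q ∈ Ideal.span {g | ∃ j : Fin n, (j : ℕ) < i + 1 ∧ g = Conv.X j ^ k} :=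
      Ideal.mul_mem_right _ _ (Ideal.subset_span ⟨x, Nat.lt_succ_self i, rfl⟩)
    have h4 := Ideal.add_mem _ h2 h3
    rwa [sub_add_cancel] at h4

theorem ofList_take_eq {n k i : ℕ} (hi : i ≤ n) :
    Ideal.ofList ((List.ofFn fun j : Fin n => Conv.X j ^ k).take i) = powIdeal n k i := by
  have h1 : {g | g ∈ (List.ofFn fun j : Fin n => (Conv.X j ^ k : Conv (Fin n))).take i} =
      {g | ∃ j : Fin n, (j : ℕ) < i ∧ g = Conv.X j ^ k} := by
    ext g
    simp only [Set.mem_ofPred_eq, List.mem_take_iff_getElem, List.getElem_ofFn, List.length_ofFn]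
    constructor
    · rintro ⟨j, hj, rfl⟩
      exact ⟨⟨j, by omega⟩, by simp; omega, rfl⟩
    · rintro ⟨j, hj, rfl⟩
      exact ⟨j, by omega, rfl⟩
  rw [Ideal.ofList, h1]
  refine le_antisymm (Ideal.span_le.2 ?_) (powIdeal_le_span hi)
  rintro g ⟨j, hj, rfl⟩
  exact X_pow_mem_powIdeal hj

/-- Multiplication by `x_i^k` shifts the exponent of `x_i` alone, while membership in the ideal of
the earlier powers does not constrain that exponent. -/
theorem isWeaklyRegular_X_pow (n k : ℕ) : RingTheory.Sequence.IsWeaklyRegular (Conv (Fin n))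
    (List.ofFn fun j : Fin n => (Conv.X j ^ k : Conv (Fin n))) := by
  rw [RingTheory.Sequence.isWeaklyRegular_iff]
  intro i hi
  rw [List.length_ofFn] at hi
  rw [ofList_take_eq hi.le, List.getElem_ofFn, smul_eq_mul, Ideal.mul_top]
  rw [isSMulRegular_iff_right_eq_zero_of_smul]
  intro f hf
  obtain ⟨f, rfl⟩ := Submodule.mkQ_surjective _ f
  rw [← map_smul, Submodule.mkQ_apply, Submodule.Quotient.mk_eq_zero, smul_eq_mul,
    mem_powIdeal] at hf
  rw [Submodule.mkQ_apply, Submodule.Quotient.mk_eq_zero, mem_powIdeal]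
  intro ν hν
  have h1 := hf (ν + Finsupp.single ⟨i, hi⟩ k) fun j hj => by
    rw [Finsupp.add_apply, Finsupp.single_eq_of_ne (fun e => hj.ne (congrArg Fin.val e)), add_zero]
    exact hν j hj
  rw [coeff_X_pow_mul, if_pos (by simp), add_tsub_cancel_right] at h1
  exact h1

/-- The class of `x_i` is a root of some `X^k q` with `q(0) ≠ 0`. Since `q(x_i)` is a unit of the
ring of germs, `x_i^k` lies in `I`; the largest `k` serves all variables. -/
theorem exists_X_pow_mem {n : ℕ} (I : Ideal (Conv (Fin n))) [Module.Finite ℂ (Conv (Fin n) ⧸ I)] :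
    ∃ k, ∀ i, Conv.X i ^ k ∈ I := by
  have h1 (i : Fin n) : ∃ k, Conv.X i ^ k ∈ I := by
    obtain ⟨p, hp, hp0⟩ := IsIntegral.of_finite ℂ (Ideal.Quotient.mk I (Conv.X i))
    obtain ⟨q, hq, hq0⟩ := Polynomial.exists_eq_pow_rootMultiplicity_mul_and_not_dvd p hp.ne_zero 0
    rw [map_zero, sub_zero] at hq hq0
    set k := p.rootMultiplicity 0
    refine ⟨k, ?_⟩
    set u : Conv (Fin n) := Polynomial.aeval (Conv.X i) q with hu
    have h2 : IsUnit u := by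
      refine isUnit_of_constantCoeff_ne_zero u ?_
      have h3 : MvPowerSeries.constantCoeff u.1 = q.eval 0 := by
        set φ : Conv (Fin n) →+* ℂ :=
          (MvPowerSeries.constantCoeff (σ := Fin n) (R := ℂ)).comp (Conv (Fin n)).val.toRingHom with hφ
        change φ u = _
        rw [hu, Polynomial.aeval_def, Polynomial.hom_eval₂]
        have h4 : φ.comp (algebraMap ℂ (Conv (Fin n))) = RingHom.id ℂ := by
          ext c
          exact MvPowerSeries.constantCoeff_C (σ := Fin n) c
        have h5 : φ (Conv.X i) = 0 := MvPowerSeries.constantCoeff_X i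
        rw [h4, h5]
        rfl
      rw [h3]
      intro h4
      exact hq0 (Polynomial.X_dvd_iff.2 (by rwa [Polynomial.coeff_zero_eq_eval_zero]))
    have h3 : Conv.X i ^ k * u ∈ I := by
      rw [← Ideal.Quotient.eq_zero_iff_mem, ← hp0]
      have h4 : Conv.X i ^ k * u = Polynomial.aeval (Conv.X i) p := by
        rw [hq, map_mul, map_pow, Polynomial.aeval_X]
      rw [h4, Polynomial.aeval_def, Polynomial.hom_eval₂]
      rfl
    exact (Ideal.mul_unit_mem_iff_mem I h2).1 h3
  choose k hk using h1
  refine ⟨Finset.univ.sup k, fun i => ?_⟩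
  exact I.pow_mem_of_pow_mem (hk i) (Finset.le_sup (Finset.mem_univ i))

/-! ### Finiteness and Koszul exactness for the Jacobian ideal. -/

theorem finite_milnorAlgebra {n : ℕ} (f : Conv (Fin n)) (hf : HasIsolatedSingularity f) :
    Module.Finite ℂ (MilnorAlgebra f) :=
  finite_quotient_of_isolated_zero n (fun i => Conv.pderiv i f) hf

/-- All relations between the partial derivatives of a germ with an isolated singularity are
trivial. -/
theorem exists_alternating_of_sum_pderiv_mul_eq_zero {n : ℕ} (f : Conv (Fin n))
    [Module.Finite ℂ (MilnorAlgebra f)] (b : Fin n → Conv (Fin n))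
    (hb : ∑ i, Conv.pderiv i f * b i = 0) :
    ∃ γ : Fin n → Fin n → Conv (Fin n), ∀ i, b i = ∑ k, Conv.pderiv k f * (γ i k - γ k i) := by
  obtain ⟨k, hk⟩ := exists_X_pow_mem (jacobianIdeal f)
  refine exists_alternating_of_isWeaklyRegular (fun i => Conv.pderiv i f) _
    (isWeaklyRegular_X_pow n k) (by simp) (fun a ha => ?_) b hb
  obtain ⟨i, rfl⟩ := (List.mem_ofFn' _ _).1 ha
  exact hk i

/-! ### Lifting exactness to formal power series -/

/-- The operator `T` on families indexed by exponents respects the filtration by the degree, and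
acts as `T₀` on leading terms. -/
def HasLeading {τ Y Z : Type} [Zero Y] (T : ((τ →₀ ℕ) → Y) → (τ →₀ ℕ) → Z) (T₀ : Y → Z) : Prop :=
  ∀ (d : ℕ) (y : (τ →₀ ℕ) → Y), (∀ ν, ν.degree < d → y ν = 0) →
    ∀ ν, ν.degree ≤ d → T y ν = T₀ (y ν)

/-- If a complex is exact on leading terms, it is exact. -/
theorem exists_eq_of_hasLeading {τ X Y Z : Type} [AddCommGroup X] [AddCommGroup Y] [AddCommGroup Z]
    (T : ((τ →₀ ℕ) → X) →+ ((τ →₀ ℕ) → Y)) (S : ((τ →₀ ℕ) → Y) →+ ((τ →₀ ℕ) → Z))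
    {T₀ : X → Y} {S₀ : Y → Z} (hT : HasLeading T T₀) (hS : HasLeading S S₀)
    (hST : ∀ x, S (T x) = 0) (h₀ : ∀ y, S₀ y = 0 → ∃ x, T₀ x = y)
    (y : (τ →₀ ℕ) → Y) (hy : S y = 0) : ∃ x, T x = y := by
  classical
  have hT0 : T₀ 0 = 0 := by
    have h := hT 0 0 (fun _ _ => rfl) 0 (by simp)
    rw [map_zero] at h
    exact h.symm
  set inv : Y → X := fun y => if h : ∃ x, T₀ x = y then h.choose else 0
  have hinv (y : Y) (h : S₀ y = 0) : T₀ (inv y) = y := by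
    have h1 := h₀ y h
    simp only [inv, dif_pos h1]
    exact h1.choose_spec
  -- The step corrects only the degree `d` part of the residue `y - T x`. By `HasLeading` it leaves
  -- the lower degrees of the residue untouched.
  set step : ℕ → ((τ →₀ ℕ) → X) → (τ →₀ ℕ) → X := fun d x ν =>
    if ν.degree = d then inv ((y - T x) ν) else 0 with hstep
  set x : ℕ → (τ →₀ ℕ) → X := fun d => Nat.rec 0 (fun d x => x + step d x) d with hx
  have hxs (d : ℕ) : x (d + 1) = x d + step d (x d) := rfl
  have hR (d : ℕ) : ∀ ν, ν.degree < d → (y - T (x d)) ν = 0 := by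
    induction d with
    | zero => exact fun ν h => absurd h (Nat.not_lt_zero _)
    | succ d ih =>
      intro ν hν
      have h1 : T (step d (x d)) ν = T₀ (step d (x d) ν) :=
        hT d _ (fun κ hκ => if_neg hκ.ne) ν (Nat.lt_succ_iff.1 hν)
      have h2 : (y - T (x (d + 1))) ν = (y - T (x d)) ν - T₀ (step d (x d) ν) := by
        rw [hxs, map_add, ← h1]
        simp only [Pi.sub_apply, Pi.add_apply]
        abel
      rw [h2]
      by_cases h3 : ν.degree = d
      · have h4 : S₀ ((y - T (x d)) ν) = 0 := by
          rw [← hS d _ ih ν h3.le, map_sub, hy, hST, sub_zero]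
          rfl
        simp only [hstep, if_pos h3]
        rw [hinv _ h4, sub_self]
      · simp only [hstep, if_neg h3]
        rw [ih ν (by omega), hT0, sub_zero]
  have hstab (ν : τ →₀ ℕ) (d : ℕ) (hd : ν.degree < d) : x d ν = x (ν.degree + 1) ν := by
    induction d, hd using Nat.le_induction with
    | base => rfl
    | succ d hd ih =>
      rw [hxs, Pi.add_apply, ih]
      simp only [hstep]
      rw [if_neg (by omega), add_zero]
  refine ⟨fun ν => x (ν.degree + 1) ν, ?_⟩
  funext ν
  set xl : (τ →₀ ℕ) → X := fun ν => x (ν.degree + 1) ν with hxl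
  -- `HasLeading` serves as continuity of `T`: the limit agrees with the approximation in all
  -- degrees up to that of `ν`, so `T` gives both the same value at `ν`.
  have h1 : T (xl - x (ν.degree + 1)) ν = T₀ ((xl - x (ν.degree + 1)) ν) :=
    hT (ν.degree + 1) _ (fun κ hκ => by rw [Pi.sub_apply, hstab κ _ hκ, sub_self]) ν (Nat.le_succ _)
  have h2 := hR (ν.degree + 1) ν (Nat.lt_succ_self _)
  rw [Pi.sub_apply, hxl, sub_self, hT0, map_sub, Pi.sub_apply] at h1
  rw [Pi.sub_apply] at h2
  rw [sub_eq_zero.1 h1, ← sub_eq_zero.1 h2]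

/-- The classes of the `e_j` form a basis of `A / ∑ ∇_i A`, and all relations `∑ ∇_i y_i = 0` are
trivial. -/
structure Resolves {A B : Type} [CommRing B] [AddCommGroup A] [Module B A] {N μ : ℕ}
    (nabla : Fin N → A →ₗ[B] A) (e : Fin μ → A) : Prop where
  exists_eq : ∀ a, ∃ (c : Fin μ → B) (y : Fin N → A),
    ∑ j, c j • e j + ∑ i, nabla i (y i) = a
  eq_zero : ∀ (c : Fin μ → B) (y : Fin N → A), ∑ j, c j • e j + ∑ i, nabla i (y i) = 0 →
    c = 0 ∧ ∃ γ : Fin N → Fin N → A, ∀ i, y i = ∑ k, nabla k (γ i k - γ k i)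

theorem sum_nabla_alternating {A B : Type} [CommRing B] [AddCommGroup A] [Module B A] {N : ℕ}
    (nabla : Fin N → A →ₗ[B] A) (hc : ∀ i k a, nabla i (nabla k a) = nabla k (nabla i a))
    (γ : Fin N → Fin N → A) : ∑ i, nabla i (∑ k, nabla k (γ i k - γ k i)) = 0 := by
  have h1 : ∑ i, nabla i (∑ k, nabla k (γ i k)) = ∑ i, nabla i (∑ k, nabla k (γ k i)) := by
    simp only [map_sum]
    rw [Finset.sum_comm]
    exact Finset.sum_congr rfl fun i _ => Finset.sum_congr rfl fun k _ => hc _ _ _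
  simp only [map_sub, Finset.sum_sub_distrib]
  rw [h1, sub_self]

section Lift

variable {τ K L : Type} [CommRing K] [CommRing L] [Algebra K L] {N μ : ℕ}

theorem coeff_smul_C (c : MvPowerSeries τ K) (e : L) (ν : τ →₀ ℕ) :
    MvPowerSeries.coeff ν (c • (MvPowerSeries.C e : MvPowerSeries τ L)) =
      MvPowerSeries.coeff ν c • e := by
  rw [Algebra.smul_def, MvPowerSeries.coeff_mul_C, MvPowerSeries.algebraMap_apply'', Algebra.smul_def]
  exact congrArg (· * e) (MvPowerSeries.coeff_map _ _ _)

theorem coeff_mul_of_low (h a : MvPowerSeries τ L) {d : ℕ}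
    (ha : ∀ ν : τ →₀ ℕ, ν.degree < d → MvPowerSeries.coeff ν a = 0) {ν : τ →₀ ℕ}
    (hν : ν.degree ≤ d) :
    MvPowerSeries.coeff ν (h * a) = MvPowerSeries.coeff 0 h * MvPowerSeries.coeff ν a := by
  classical
  rw [MvPowerSeries.coeff_mul, Finset.sum_eq_single (0, ν)]
  · rintro ⟨p, q⟩ hpq hne
    have hpq : p + q = ν := Finset.HasAntidiagonal.mem_antidiagonal.1 hpq
    have h1 : p.degree ≠ 0 := fun e => by
      rw [Finsupp.degree_eq_zero_iff] at e
      subst e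
      exact hne (by rw [← hpq, zero_add])
    have h2 : p.degree + q.degree = ν.degree := by rw [← hpq, map_add]
    rw [ha q (by omega), mul_zero]
  · simp [Finset.HasAntidiagonal.mem_antidiagonal]

/-- The property `Resolves` lifts from the leading terms of commuting operators on power series. -/
theorem resolves_lift {nabla : Fin N → MvPowerSeries τ L →ₗ[MvPowerSeries τ K] MvPowerSeries τ L}
    (hc : ∀ i k a, nabla i (nabla k a) = nabla k (nabla i a)) {nabla₀ : Fin N → L →ₗ[K] L}
    (hlead : ∀ i, HasLeading (τ := τ) (nabla i) (nabla₀ i)) {e : Fin μ → L}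
    (h : Resolves nabla₀ e) : Resolves nabla fun j => (MvPowerSeries.C (e j) : MvPowerSeries τ L) := by
  set S : ((τ →₀ ℕ) → (Fin μ → K) × (Fin N → L)) →+ ((τ →₀ ℕ) → L) :=
    { toFun := fun x => (∑ j, series (fun ν => (x ν).1 j) • (MvPowerSeries.C (e j) : MvPowerSeries τ L)
        + ∑ i, nabla i (series fun ν => (x ν).2 i) : MvPowerSeries τ L)
      map_zero' := by
        change (∑ j, (0 : MvPowerSeries τ K) • (MvPowerSeries.C (e j) : MvPowerSeries τ L)
          + ∑ i, nabla i (0 : MvPowerSeries τ L) : MvPowerSeries τ L) = 0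
        simp
      map_add' := fun x y => by
        change (∑ j, (series (fun ν => (x ν).1 j) + series (fun ν => (y ν).1 j)) •
            (MvPowerSeries.C (e j) : MvPowerSeries τ L) +
          ∑ i, nabla i ((series fun ν => (x ν).2 i) + series fun ν => (y ν).2 i) :
            MvPowerSeries τ L) = _ + _
        simp only [add_smul, map_add, Finset.sum_add_distrib]
        exact add_add_add_comm _ _ _ _ } with hS
  have hSlead : HasLeading S fun x : (Fin μ → K) × (Fin N → L) =>
      ∑ j, x.1 j • e j + ∑ i, nabla₀ i (x.2 i) := by
    intro d x hx ν hν
    change MvPowerSeries.coeff ν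
      (∑ j, series (fun ν => (x ν).1 j) • (MvPowerSeries.C (e j) : MvPowerSeries τ L)
        + ∑ i, nabla i (series fun ν => (x ν).2 i) : MvPowerSeries τ L) = _
    rw [map_add, map_sum, map_sum]
    refine congrArg₂ _ (Finset.sum_congr rfl fun j _ => coeff_smul_C _ _ _)
      (Finset.sum_congr rfl fun i _ => ?_)
    exact hlead i d (fun ν => (x ν).2 i) (fun κ hκ => by rw [hx κ hκ]; rfl) ν hν
  constructor
  · intro a
    -- Surjectivity of `S` is exactness against the zero map.
    obtain ⟨x, hx⟩ := exists_eq_of_hasLeading S (0 : ((τ →₀ ℕ) → L) →+ ((τ →₀ ℕ) → Unit)) hSlead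
      (S₀ := fun _ => ()) (fun _ _ _ _ _ => rfl) (fun _ => rfl)
      (fun y _ => by
        obtain ⟨c, y', h1⟩ := h.exists_eq y
        exact ⟨(c, y'), h1⟩) a rfl
    exact ⟨fun j => series fun ν => (x ν).1 j, fun i => series fun ν => (x ν).2 i, hx⟩
  · intro c y hcy
    set T : ((τ →₀ ℕ) → Fin N → Fin N → L) →+ ((τ →₀ ℕ) → (Fin μ → K) × (Fin N → L)) :=
      { toFun := fun γ ν => (0, fun i => MvPowerSeries.coeff ν
          (∑ k, nabla k ((series fun ν => γ ν i k) - series fun ν => γ ν k i)))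
        map_zero' := by
          funext ν
          refine Prod.ext rfl (funext fun i => ?_)
          change MvPowerSeries.coeff ν
            (∑ k, nabla k ((0 : MvPowerSeries τ L) - (0 : MvPowerSeries τ L))) = 0
          simp
        map_add' := fun γ γ' => by
          funext ν
          refine Prod.ext (add_zero 0).symm (funext fun i => ?_)
          change MvPowerSeries.coeff ν
            (∑ k, nabla k (((series fun ν => γ ν i k) + (series fun ν => γ' ν i k)) -
              ((series fun ν => γ ν k i) + (series fun ν => γ' ν k i)))) =
            MvPowerSeries.coeff ν
              (∑ k, nabla k ((series fun ν => γ ν i k) - series fun ν => γ ν k i)) +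
            MvPowerSeries.coeff ν
              (∑ k, nabla k ((series fun ν => γ' ν i k) - series fun ν => γ' ν k i))
          rw [← map_add, ← Finset.sum_add_distrib]
          simp only [← map_add, add_sub_add_comm] } with hT
    have hTlead : HasLeading T fun γ : Fin N → Fin N → L =>
        ((0, fun i => ∑ k, nabla₀ k (γ i k - γ k i)) : (Fin μ → K) × (Fin N → L)) := by
      intro d γ hγ ν hν
      refine Prod.ext rfl (funext fun i => ?_)
      change MvPowerSeries.coeff ν
          (∑ k, nabla k ((series fun ν => γ ν i k) - series fun ν => γ ν k i)) =
        ∑ k, nabla₀ k (γ ν i k - γ ν k i)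
      rw [map_sum]
      exact Finset.sum_congr rfl fun k _ => hlead k d (fun ν => γ ν i k - γ ν k i)
        (fun κ hκ => by rw [hγ κ hκ]; exact sub_self _) ν hν
    have hST (γ : (τ →₀ ℕ) → Fin N → Fin N → L) : S (T γ) = 0 := by
      change (∑ j, (0 : MvPowerSeries τ K) • (MvPowerSeries.C (e j) : MvPowerSeries τ L)
        + ∑ i, nabla i (∑ k, nabla k ((series fun ν => γ ν i k) - series fun ν => γ ν k i)) :
          MvPowerSeries τ L) = 0
      rw [sum_nabla_alternating nabla hc fun i k => series fun ν => γ ν i k]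
      simp
    obtain ⟨γ, hγ⟩ := exists_eq_of_hasLeading T S hTlead hSlead hST (fun x hx => by
      obtain ⟨h1, γ, h2⟩ := h.eq_zero x.1 x.2 hx
      exact ⟨γ, Prod.ext h1.symm (funext fun i => (h2 i).symm)⟩)
      (fun ν => (fun j => MvPowerSeries.coeff ν (c j), fun i => MvPowerSeries.coeff ν (y i))) hcy
    refine ⟨funext fun j => MvPowerSeries.ext fun ν => ?_, fun i k => series fun ν => γ ν i k,
      fun i => MvPowerSeries.ext fun ν => ?_⟩
    · exact (congrFun (congrArg Prod.fst (congrFun hγ ν)) j).symm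
    · exact (congrFun (congrArg Prod.snd (congrFun hγ ν)) i).symm

/-- The operator `u D - g`. -/
def nablaZero (u : K) (D : L →ₗ[K] L) (g : L) : L →ₗ[K] L := u • D - LinearMap.mulLeft K g

/-- The coefficients of `Φ` at positive powers of `s` raise the degree, so only the constant one
survives on leading terms. -/
theorem hasLeading_nablaOp (u : K) (D : Fin N → L →ₗ[K] L) (j : Conv (Fin N) →+* L)
    (Φ : MvPowerSeries τ (Conv (Fin N))) (i : Fin N) :
    HasLeading (τ := τ) (nablaOp u D j Φ i)
      (nablaZero u (D i) (j (Conv.pderiv i (MvPowerSeries.coeff 0 Φ)))) := by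
  intro d (a : MvPowerSeries τ L) ha ν hν
  have h1 : MvPowerSeries.coeff ν ((MvPowerSeries.C u : MvPowerSeries τ K) • coeffwise (D i) a) =
      u • D i (MvPowerSeries.coeff ν a) := by
    rw [Algebra.smul_def, MvPowerSeries.algebraMap_apply'', MvPowerSeries.map_C,
      MvPowerSeries.coeff_C_mul, Algebra.smul_def]
    rfl
  have h2 := coeff_mul_of_low (series fun ν => j (Conv.pderiv i (MvPowerSeries.coeff ν Φ))) a
    ha hν
  change MvPowerSeries.coeff ν ((MvPowerSeries.C u : MvPowerSeries τ K) • coeffwise (D i) a -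
    (series fun ν => j (Conv.pderiv i (MvPowerSeries.coeff ν Φ))) * a) = _
  rw [map_sub, h1, h2]
  rfl

end Lift

/-! ### Top cohomology -/

/-- In `n + 1` variables every top form is closed, and an `n`-form is a tuple indexed by the omitted
variable. Up to signs the coboundaries are thus the sums `∑ ∇_i y_i`. -/
theorem Resolves.isFiniteFreeOfRank {A B : Type} [CommRing B] [Nontrivial B] [AddCommGroup A]
    [Module B A] {n μ : ℕ} {nabla : Fin (n + 1) → A →ₗ[B] A} {e : Fin μ → A}
    (h : Resolves nabla e) : IsFiniteFreeOfRank B (FormCohomology nabla n) μ := by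
  classical
  have hker (ω : Forms (n + 1) (n + 1) A) : ω ∈ LinearMap.ker (formD nabla (n + 1)) := by
    rw [LinearMap.mem_ker]
    funext I
    have h1 := Finset.card_le_univ I.1
    rw [I.2, Fintype.card_fin] at h1
    omega
  set U : {I : Finset (Fin (n + 1)) // I.card = n + 1} := ⟨Finset.univ, by simp⟩ with hU
  have hun (I : {I : Finset (Fin (n + 1)) // I.card = n + 1}) : I = U :=
    Subtype.ext ((Finset.card_eq_iff_eq_univ _).1 (I.2.trans (Fintype.card_fin _).symm))
  set sgn : Fin (n + 1) → ℤ := fun i => (-1) ^ (Finset.univ.filter (· < i)).card with hsgn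
  have hsq (i : Fin (n + 1)) : sgn i * sgn i = 1 := by
    simp only [hsgn, ← mul_pow]
    norm_num
  have hcard (i : Fin (n + 1)) : ((Finset.univ : Finset (Fin (n + 1))).erase i).card = n := by
    rw [Finset.card_erase_of_mem (Finset.mem_univ i)]
    simp
  have hform (η : Forms (n + 1) n A) :
      formD nabla n η U = ∑ i, nabla i (sgn i • η ⟨Finset.univ.erase i, hcard i⟩) := by
    rw [formD_apply_eq_sum nabla n η
      (fun J => if h : J.card = n then η ⟨J, h⟩ else 0) (fun J => by simp [J.2])]
    refine Finset.sum_congr rfl fun i _ => ?_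
    have h1 : (U.1.erase i).card = n := hcard i
    rw [dif_pos h1, map_zsmul]
  set Ψ : (Fin μ → B) →ₗ[B] FormCohomology nabla n :=
    (Submodule.mkQ _).comp (LinearMap.codRestrict (LinearMap.ker (formD nabla (n + 1)))
      (LinearMap.pi fun _ => Fintype.linearCombination B e) fun c => hker _) with hΨ
  have hinj : Function.Injective Ψ := by
    rw [injective_iff_map_eq_zero]
    intro c hc
    rw [hΨ, LinearMap.comp_apply, Submodule.mkQ_apply, Submodule.Quotient.mk_eq_zero] at hc
    obtain ⟨η, hη⟩ := hc
    have h1 := congrFun hη U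
    rw [hform] at h1
    refine (h.eq_zero c (fun i => -(sgn i • η ⟨Finset.univ.erase i, hcard i⟩)) ?_).1
    simp only [map_neg, Finset.sum_neg_distrib]
    rw [h1, add_neg_eq_zero]
    rfl
  have hsurj : Function.Surjective Ψ := by
    intro a
    obtain ⟨⟨ω, hω⟩, rfl⟩ := Submodule.mkQ_surjective _ a
    obtain ⟨c, y, hcy⟩ := h.exists_eq (ω U)
    refine ⟨c, ?_⟩
    rw [hΨ, LinearMap.comp_apply, ← sub_eq_zero, ← map_sub, Submodule.mkQ_apply,
      Submodule.Quotient.mk_eq_zero]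
    -- The complement of the index set of an `n`-form is a single index, so the sum only selects the
    -- matching `y i`.
    refine ⟨fun J => ∑ i ∈ J.1ᶜ, -(sgn i • y i), funext fun I => ?_⟩
    rw [hun I, hform]
    have h1 (i : Fin (n + 1)) : ((Finset.univ : Finset (Fin (n + 1))).erase i)ᶜ = {i} := by
      ext k
      simp
    simp only [h1, Finset.sum_singleton, smul_neg, smul_smul, hsq, one_smul, map_neg,
      Finset.sum_neg_distrib]
    change _ = ∑ j, c j • e j - ω U
    rw [← hcy]
    abel
  have E := LinearEquiv.ofBijective Ψ ⟨hinj, hsurj⟩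
  exact ⟨Module.Free.of_equiv E, Module.Finite.equiv E, by rw [← E.finrank_eq]; simp⟩

/-! ### Localization -/

/-- Clearing denominators: the operators commute with multiplication by `u`, so elements and
relations over `B'` come from `B` after multiplication by a power of the invertible `φ u`. -/
theorem Resolves.localize {A B A' B' : Type} [CommRing B] [CommRing B'] [AddCommGroup A]
    [AddCommGroup A'] [Module B A] [Module B' A'] {N μ : ℕ} {nabla : Fin N → A →ₗ[B] A}
    {nabla' : Fin N → A' →ₗ[B'] A'} (φ : B →+* B') (ψ : A →+ A') (u : B) (v : B')
    (huv : φ u * v = 1) (hψi : Function.Injective ψ) (hψ : ∀ b a, ψ (b • a) = φ b • ψ a)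
    (hnabla : ∀ i a, ψ (nabla i a) = nabla' i (ψ a))
    (hφs : ∀ b', ∃ (k : ℕ) (b : B), φ u ^ k * b' = φ b)
    (hψs : ∀ a', ∃ (k : ℕ) (a : A), φ u ^ k • a' = ψ a)
    {e : Fin μ → A} (h : Resolves nabla e) : Resolves nabla' fun j => ψ (e j) := by
  have huvk (k : ℕ) : v ^ k * φ u ^ k = 1 := by rw [← mul_pow, mul_comm, huv, one_pow]
  constructor
  · intro a'
    obtain ⟨k, a, ha⟩ := hψs a'
    obtain ⟨c, y, hcy⟩ := h.exists_eq a
    refine ⟨fun j => v ^ k * φ (c j), fun i => v ^ k • ψ (y i), ?_⟩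
    have h1 : ∑ j, φ (c j) • ψ (e j) + ∑ i, nabla' i (ψ (y i)) = φ u ^ k • a' := by
      rw [ha, ← hcy, map_add, map_sum, map_sum]
      simp only [hψ, hnabla]
    simp only [mul_smul, map_smul]
    rw [← Finset.smul_sum, ← Finset.smul_sum, ← smul_add, h1, smul_smul, huvk, one_smul]
  · intro c' y' hcy
    choose k c hc using fun j => hφs (c' j)
    choose l y hy using fun i => hψs (y' i)
    set m := ∑ j, k j + ∑ i, l i with hm
    have hk (j : Fin μ) : k j ≤ m :=
      (Finset.single_le_sum (fun _ _ => Nat.zero_le _) (Finset.mem_univ j)).trans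
        (Nat.le_add_right _ _)
    have hl (i : Fin N) : l i ≤ m :=
      (Finset.single_le_sum (fun _ _ => Nat.zero_le _) (Finset.mem_univ i)).trans
        (Nat.le_add_left _ _)
    have hc' (j : Fin μ) : φ u ^ m * c' j = φ (u ^ (m - k j) * c j) := by
      rw [map_mul, ← hc, map_pow, ← mul_assoc, ← pow_add, Nat.sub_add_cancel (hk j)]
    have hy' (i : Fin N) : φ u ^ m • y' i = ψ (u ^ (m - l i) • y i) := by
      rw [hψ, ← hy, map_pow, smul_smul, ← pow_add, Nat.sub_add_cancel (hl i)]
    have h1 : ∑ j, (u ^ (m - k j) * c j) • e j + ∑ i, nabla i (u ^ (m - l i) • y i) = 0 := by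
      apply hψi
      have e1 (j : Fin μ) : ψ ((u ^ (m - k j) * c j) • e j) = φ u ^ m • c' j • ψ (e j) := by
        rw [hψ, ← hc', mul_smul]
      have e2 (i : Fin N) : ψ (nabla i (u ^ (m - l i) • y i)) = φ u ^ m • nabla' i (y' i) := by
        rw [hnabla, ← hy', map_smul]
      rw [map_add, map_sum, map_sum, map_zero]
      simp only [e1, e2]
      rw [← Finset.smul_sum, ← Finset.smul_sum, ← smul_add, hcy, smul_zero]
    obtain ⟨h2, γ, hγ⟩ := h.eq_zero (fun j => u ^ (m - k j) * c j) (fun i => u ^ (m - l i) • y i) h1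
    refine ⟨funext fun j => ?_, fun i k => v ^ m • ψ (γ i k), fun i => ?_⟩
    · have h3 := hc' j
      rw [show u ^ (m - k j) * c j = 0 from congrFun h2 j, map_zero] at h3
      rw [Pi.zero_apply, ← one_mul (c' j), ← huvk m, mul_assoc, h3, mul_zero]
    · have h3 := hy' i
      rw [hγ i, map_sum] at h3
      simp only [hnabla, map_sub] at h3
      rw [← one_smul B' (y' i), ← huvk m, mul_smul, h3, Finset.smul_sum]
      simp only [← smul_sub, map_smul, map_sub]

/-! ### The Milnor algebra and the lattices at `s = 0` -/

/-- The base case `u = 0`, `s = 0`: lifts of a basis of the Milnor algebra, together with Koszul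
exactness for the relations. -/
theorem resolves_milnor {N : ℕ} (f : Conv (Fin N)) [Module.Finite ℂ (MilnorAlgebra f)] :
    ∃ e : Fin (milnorNumber f) → Conv (Fin N),
      Resolves (B := ℂ) (fun i => -LinearMap.mulLeft ℂ (Conv.pderiv i f)) e := by
  have hfree : Module.Free ℂ (MilnorAlgebra f) := Module.Free.of_divisionRing ℂ _
  set bs : Module.Basis (Fin (milnorNumber f)) ℂ (MilnorAlgebra f) :=
    Module.finBasis ℂ (MilnorAlgebra f)
  choose e he using fun j => Ideal.Quotient.mk_surjective (bs j)
  refine ⟨e, ?_, ?_⟩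
  · intro a
    set c := bs.repr (Ideal.Quotient.mk _ a) with hc
    have h1 : a - ∑ j, c j • e j ∈ jacobianIdeal f := by
      rw [← Ideal.Quotient.eq_zero_iff_mem, map_sub, map_sum]
      have h2 (j) : Ideal.Quotient.mk (jacobianIdeal f) (c j • e j) = c j • bs j := by
        rw [← he]
        rfl
      simp only [h2]
      rw [bs.sum_repr, sub_self]
    obtain ⟨y, hy⟩ := Ideal.mem_span_range_iff_exists_fun.1 h1
    refine ⟨c, fun i => -y i, ?_⟩
    have h3 : ∑ i, (-LinearMap.mulLeft ℂ (Conv.pderiv i f)) (-y i) = a - ∑ j, c j • e j := by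
      rw [← hy]
      refine Finset.sum_congr rfl fun i _ => ?_
      rw [map_neg, LinearMap.neg_apply, neg_neg, LinearMap.mulLeft_apply, mul_comm]
    rw [h3]
    exact add_sub_cancel _ _
  · intro c y hcy
    have h1 : ∑ j, c j • bs j = 0 := by
      have h2 := congrArg (Ideal.Quotient.mk (jacobianIdeal f)) hcy
      rw [map_add, map_sum, map_sum, map_zero] at h2
      have h3 (j) : Ideal.Quotient.mk (jacobianIdeal f) (c j • e j) = c j • bs j := by
        rw [← he]
        rfl
      have h4 (i) : Ideal.Quotient.mk (jacobianIdeal f)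
          ((-LinearMap.mulLeft ℂ (Conv.pderiv i f)) (y i)) = 0 := by
        rw [Ideal.Quotient.eq_zero_iff_mem, LinearMap.neg_apply, LinearMap.mulLeft_apply]
        exact Ideal.neg_mem_iff _ |>.2 (Ideal.mul_mem_right _ _ (Ideal.subset_span ⟨i, rfl⟩))
      simpa only [h3, h4, Finset.sum_const_zero, add_zero] using h2
    have hc : c = 0 := funext (Fintype.linearIndependent_iff.1 bs.linearIndependent c h1)
    refine ⟨hc, ?_⟩
    rw [hc] at hcy
    have h2 : ∑ i, Conv.pderiv i f * y i = 0 := by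
      have h3 : ∑ i, (-LinearMap.mulLeft ℂ (Conv.pderiv i f)) (y i) = 0 := by simpa using hcy
      simpa [Finset.sum_neg_distrib] using h3
    obtain ⟨γ, hγ⟩ := exists_alternating_of_sum_pderiv_mul_eq_zero f y h2
    -- Transposing `γ` absorbs the sign of the operators.
    refine ⟨fun i k => γ k i, fun i => ?_⟩
    rw [hγ i]
    refine Finset.sum_congr rfl fun k _ => ?_
    rw [LinearMap.neg_apply, LinearMap.mulLeft_apply, ← mul_neg, neg_sub]

/-- The operators `u ∂_{x_i} - ∂_{x_i} f` on `ℂ{x}[[u]]`. -/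
def powerNablaZero {N : ℕ} (f : Conv (Fin N)) (i : Fin N) :
    PowerSeries (Conv (Fin N)) →ₗ[PowerSeries ℂ] PowerSeries (Conv (Fin N)) :=
  nablaZero (K := PowerSeries ℂ) (L := PowerSeries (Conv (Fin N)))
    PowerSeries.X (powerD i) (PowerSeries.C (Conv.pderiv i f))

/-- The operators `u ∂_{x_i} - ∂_{x_i} f` on `ℂ{x}((u))`. -/
def laurentNablaZero {N : ℕ} (f : Conv (Fin N)) (i : Fin N) :
    LaurentSeries (Conv (Fin N)) →ₗ[LaurentSeries ℂ] LaurentSeries (Conv (Fin N)) :=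
  nablaZero (K := LaurentSeries ℂ) (L := LaurentSeries (Conv (Fin N)))
    (HahnSeries.single 1 1) (laurentD i) (HahnSeries.C (Conv.pderiv i f))

theorem powerNablaZero_apply {N : ℕ} (f : Conv (Fin N)) (i : Fin N)
    (a : PowerSeries (Conv (Fin N))) : powerNablaZero f i a =
      PowerSeries.X * powerD i a - PowerSeries.C (Conv.pderiv i f) * a := by
  have h : (PowerSeries.X : PowerSeries ℂ) • powerD i a = PowerSeries.X * powerD i a := by
    rw [Algebra.smul_def]
    congr 1
    exact PowerSeries.map_X _
  rw [← h]
  rfl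

theorem hasLeading_powerNabla {N : ℕ} {τ : Type} (Φ : MvPowerSeries τ (Conv (Fin N))) (i : Fin N) :
    HasLeading (τ := τ) (powerNabla Φ i) (powerNablaZero (MvPowerSeries.coeff 0 Φ) i) :=
  hasLeading_nablaOp _ _ _ Φ i

theorem hasLeading_laurentNabla {N : ℕ} {τ : Type} (Φ : MvPowerSeries τ (Conv (Fin N)))
    (i : Fin N) :
    HasLeading (τ := τ) (laurentNabla Φ i) (laurentNablaZero (MvPowerSeries.coeff 0 Φ) i) :=
  hasLeading_nablaOp _ _ _ Φ i

theorem powerNablaZero_comm {N : ℕ} (f : Conv (Fin N)) (i k : Fin N)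
    (a : PowerSeries (Conv (Fin N))) : powerNablaZero f i (powerNablaZero f k a) =
      powerNablaZero f k (powerNablaZero f i a) := by
  -- An auxiliary parameter is adjoined: commutation is known for the constant deformation and is
  -- read off at its constant coefficient.
  set Φ : MvPowerSeries Unit (Conv (Fin N)) := MvPowerSeries.C f with hΦ
  have h1 (i : Fin N) (b : MvPowerSeries Unit (PowerSeries (Conv (Fin N)))) :
      MvPowerSeries.coeff 0 (powerNabla Φ i b) = powerNablaZero f i (MvPowerSeries.coeff 0 b) := by
    have h2 := hasLeading_powerNabla Φ i 0 b (fun ν h => absurd h (Nat.not_lt_zero _)) 0 (by simp)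
    rw [hΦ, MvPowerSeries.coeff_zero_C] at h2
    exact h2
  have h3 := congrArg (MvPowerSeries.coeff 0) (powerNabla_comm Φ i k (MvPowerSeries.C a))
  rwa [h1, h1, h1, h1, MvPowerSeries.coeff_zero_C] at h3

/-- A power series in `u` is a series indexed by `Unit`, so `u` can play the role of `s`. The term
`u ∂_i` raises the degree and disappears from the leading part. -/
theorem hasLeading_powerNablaZero {N : ℕ} (f : Conv (Fin N)) (i : Fin N) :
    HasLeading (τ := Unit) (powerNablaZero f i) (-LinearMap.mulLeft ℂ (Conv.pderiv i f)) := by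
  intro d (a : MvPowerSeries Unit (Conv (Fin N))) ha ν hν
  have h1 := coeff_mul_of_low (PowerSeries.X : PowerSeries (Conv (Fin N))) (powerD i a)
    (d := d) (fun κ hκ => by
      change Conv.pderiv i (MvPowerSeries.coeff κ a) = 0
      have h2 : MvPowerSeries.coeff κ a = 0 := ha κ hκ
      rw [h2, map_zero]) hν
  have h2 := coeff_mul_of_low (PowerSeries.C (Conv.pderiv i f) : PowerSeries (Conv (Fin N))) a
    ha hν
  have h3 : MvPowerSeries.coeff 0 (PowerSeries.X : PowerSeries (Conv (Fin N))) = 0 :=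
    MvPowerSeries.coeff_zero_X _
  have h4 : MvPowerSeries.coeff 0 (PowerSeries.C (Conv.pderiv i f) : PowerSeries (Conv (Fin N))) =
    Conv.pderiv i f := MvPowerSeries.coeff_zero_C _
  have h5 : MvPowerSeries.coeff ν (powerNablaZero f i a) =
      MvPowerSeries.coeff ν (PowerSeries.X * powerD i a) -
        MvPowerSeries.coeff ν (PowerSeries.C (Conv.pderiv i f) * a) := by
    rw [powerNablaZero_apply]
    exact map_sub (MvPowerSeries.coeff ν) _ _
  refine h5.trans ?_
  rw [h1, h2, h3, h4, zero_mul, zero_sub]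
  rfl

theorem resolves_powerNablaZero {N μ : ℕ} (f : Conv (Fin N)) {e : Fin μ → Conv (Fin N)}
    (h : Resolves (B := ℂ) (fun i => -LinearMap.mulLeft ℂ (Conv.pderiv i f)) e) :
    Resolves (powerNablaZero f) fun j => PowerSeries.C (e j) :=
  resolves_lift (τ := Unit) (nabla := powerNablaZero f) (powerNablaZero_comm f)
    (hasLeading_powerNablaZero f) h

theorem ofPowerSeries_coeff {R : Type} [CommRing R] (a : PowerSeries R) (n : ℤ) :
    (HahnSeries.ofPowerSeries ℤ R a).coeff n = if n < 0 then 0 else PowerSeries.coeff n.natAbs a :=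
  PowerSeries.coeff_coe a n

theorem exists_single_pow_mul_eq {R : Type} [CommRing R] (a : LaurentSeries R) :
    ∃ (k : ℕ) (b : PowerSeries R),
      HahnSeries.ofPowerSeries ℤ R PowerSeries.X ^ k * a = HahnSeries.ofPowerSeries ℤ R b := by
  -- The exponent `|order|` cancels any pole, and the sum of the order and its absolute value is
  -- never negative.
  refine ⟨a.order.natAbs, PowerSeries.X ^ (a.order + a.order.natAbs).toNat * a.powerSeriesPart, ?_⟩
  have h := LaurentSeries.single_order_mul_powerSeriesPart a
  set b := a.powerSeriesPart
  set d := a.order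
  rw [← h, map_mul, ← map_pow, HahnSeries.ofPowerSeries_X_pow, HahnSeries.ofPowerSeries_X_pow, ← mul_assoc,
    HahnSeries.single_mul_single, mul_one]
  have hd : (d.natAbs : ℤ) + d = ((d + d.natAbs).toNat : ℕ) := by omega
  rw [hd]

theorem resolves_laurentNablaZero {N μ : ℕ} (f : Conv (Fin N))
    {e : Fin μ → PowerSeries (Conv (Fin N))} (h : Resolves (powerNablaZero f) e) :
    Resolves (laurentNablaZero f) fun j => HahnSeries.ofPowerSeries ℤ (Conv (Fin N)) (e j) := by
  have hsmul (b : PowerSeries ℂ) (a : PowerSeries (Conv (Fin N))) :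
      HahnSeries.ofPowerSeries ℤ (Conv (Fin N)) (b • a) =
        HahnSeries.ofPowerSeries ℤ ℂ b • HahnSeries.ofPowerSeries ℤ (Conv (Fin N)) a := by
    rw [Algebra.smul_def, Algebra.smul_def, map_mul]
    congr 1
    ext1
    funext n
    change _ = algebraMap ℂ (Conv (Fin N)) ((HahnSeries.ofPowerSeries ℤ ℂ b).coeff n)
    rw [ofPowerSeries_coeff, ofPowerSeries_coeff]
    split_ifs
    · exact (map_zero _).symm
    · exact PowerSeries.coeff_map _ _ _
  have hX : HahnSeries.ofPowerSeries ℤ ℂ PowerSeries.X = HahnSeries.single 1 1 :=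
    HahnSeries.ofPowerSeries_X
  have hinj : Function.Injective (HahnSeries.ofPowerSeries ℤ (Conv (Fin N))) :=
    HahnSeries.ofPowerSeries_injective
  set ψ : PowerSeries (Conv (Fin N)) →+ LaurentSeries (Conv (Fin N)) :=
    (HahnSeries.ofPowerSeries ℤ (Conv (Fin N))).toAddMonoidHom
  refine Resolves.localize (A := PowerSeries (Conv (Fin N))) (A' := LaurentSeries (Conv (Fin N)))
    (nabla := powerNablaZero f) (nabla' := laurentNablaZero f) (HahnSeries.ofPowerSeries ℤ ℂ) ψ
    PowerSeries.X (HahnSeries.single (-1) 1) ?_ hinj hsmul (fun i a => ?_)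
    exists_single_pow_mul_eq (fun a => ?_) h
  · rw [hX, HahnSeries.single_mul_single]
    simp
  · change HahnSeries.ofPowerSeries ℤ (Conv (Fin N)) ((PowerSeries.X : PowerSeries ℂ) • powerD i a -
      PowerSeries.C (Conv.pderiv i f) * a) =
      (HahnSeries.single 1 1 : LaurentSeries ℂ) •
        laurentD i (HahnSeries.ofPowerSeries ℤ (Conv (Fin N)) a) -
      HahnSeries.C (Conv.pderiv i f) * HahnSeries.ofPowerSeries ℤ (Conv (Fin N)) a
    rw [map_sub, map_mul, HahnSeries.ofPowerSeries_C, hsmul, hX]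
    congr 2
    ext1
    funext n
    change _ = Conv.pderiv i ((HahnSeries.ofPowerSeries ℤ (Conv (Fin N)) a).coeff n)
    rw [ofPowerSeries_coeff, ofPowerSeries_coeff]
    split_ifs
    · exact (map_zero _).symm
    · rfl
  · obtain ⟨k, b, hb⟩ := exists_single_pow_mul_eq a
    refine ⟨k, b, ?_⟩
    refine Eq.trans ?_ hb
    rw [← map_pow, ← map_pow, Algebra.smul_def]
    congr 1
    rw [HahnSeries.ofPowerSeries_X_pow, HahnSeries.ofPowerSeries_X_pow]
    ext1
    funext n
    change algebraMap ℂ (Conv (Fin N)) ((HahnSeries.single (k : ℤ) (1 : ℂ)).coeff n) = _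
    rw [HahnSeries.coeff_single, HahnSeries.coeff_single]
    split_ifs
    · exact map_one _
    · exact map_zero _

/-! ### Assembly of the lifts. -/

theorem isFiniteFreeOfRank_gaussManinSystem {n : ℕ} {τ : Type}
    (Φ : MvPowerSeries τ (Conv (Fin (n + 1))))
    [Module.Finite ℂ (MilnorAlgebra (MvPowerSeries.coeff 0 Φ))] :
    IsFiniteFreeOfRank (MvPowerSeries τ (LaurentSeries ℂ)) (GaussManinSystem Φ)
      (milnorNumber (MvPowerSeries.coeff 0 Φ)) := by
  obtain ⟨e, he⟩ := resolves_milnor (MvPowerSeries.coeff 0 Φ)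
  -- The inversion of `u` precedes the lift in `s`: in a series over `ℂ((u))` the pole orders of the
  -- coefficients may be unbounded, so in general `ℂ((u))[[s]]` is not obtained from `ℂ[[u]][[s]]`
  -- by inverting `u`.
  exact (resolves_lift (laurentNabla_comm Φ) (hasLeading_laurentNabla Φ)
    (resolves_laurentNablaZero _ (resolves_powerNablaZero _ he))).isFiniteFreeOfRank

theorem isFiniteFreeOfRank_brieskornLattice {n : ℕ} {τ : Type}
    (Φ : MvPowerSeries τ (Conv (Fin (n + 1))))
    [Module.Finite ℂ (MilnorAlgebra (MvPowerSeries.coeff 0 Φ))] :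
    IsFiniteFreeOfRank (MvPowerSeries τ (PowerSeries ℂ)) (BrieskornLattice Φ)
      (milnorNumber (MvPowerSeries.coeff 0 Φ)) := by
  obtain ⟨e, he⟩ := resolves_milnor (MvPowerSeries.coeff 0 Φ)
  exact (resolves_lift (powerNabla_comm Φ) (hasLeading_powerNabla Φ)
    (resolves_powerNablaZero _ he)).isFiniteFreeOfRank

end GaussManin

end

theorem proposition1p2 (n m : ℕ) (f : GaussManin.Conv (Fin (n + 1)))
    (hf : GaussManin.HasIsolatedSingularity f)
    (F : GaussManin.Conv (Fin (n + 1) ⊕ Fin m)) (hF : GaussManin.IsDeformation f F) :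
    Module.Finite ℂ (GaussManin.MilnorAlgebra f) ∧
    (GaussManin.IsFiniteFreeOfRank (MvPowerSeries (Fin m) (LaurentSeries ℂ))
        (GaussManin.GaussManinSystem (GaussManin.sExpand F)) (GaussManin.milnorNumber f) ∧
      GaussManin.IsFiniteFreeOfRank (MvPowerSeries (Fin m) (PowerSeries ℂ))
        (GaussManin.BrieskornLattice (GaussManin.sExpand F)) (GaussManin.milnorNumber f)) ∧
    (GaussManin.IsFiniteFreeOfRank (MvPowerSeries (Fin m) (LaurentSeries ℂ))
        (GaussManin.GaussManinSystem (MvPowerSeries.C f : MvPowerSeries (Fin m) _))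
        (GaussManin.milnorNumber f) ∧
      GaussManin.IsFiniteFreeOfRank (MvPowerSeries (Fin m) (PowerSeries ℂ))
        (GaussManin.BrieskornLattice (MvPowerSeries.C f : MvPowerSeries (Fin m) _))
        (GaussManin.milnorNumber f)) := by
  have hfin := GaussManin.finite_milnorAlgebra f hf
  have key (Φ : MvPowerSeries (Fin m) (GaussManin.Conv (Fin (n + 1))))
      (hΦ : MvPowerSeries.coeff 0 Φ = f) :
      GaussManin.IsFiniteFreeOfRank (MvPowerSeries (Fin m) (LaurentSeries ℂ))
        (GaussManin.GaussManinSystem Φ) (GaussManin.milnorNumber f) ∧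
      GaussManin.IsFiniteFreeOfRank (MvPowerSeries (Fin m) (PowerSeries ℂ))
        (GaussManin.BrieskornLattice Φ) (GaussManin.milnorNumber f) := by
    subst hΦ
    exact ⟨GaussManin.isFiniteFreeOfRank_gaussManinSystem Φ,
      GaussManin.isFiniteFreeOfRank_brieskornLattice Φ⟩
  -- By definition `hF` says that the constant coefficient of `sExpand F` is `f`.
  exact ⟨hfin, key _ hF, key _ (MvPowerSeries.coeff_zero_C f)⟩
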